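/- Fix constants $\beta>0$, $0<c_1<1$ and $0<c_{\mathrm{lo}},c_{\mathrm{hi}}<\infty$. **Setting.** Let $T\ge 1$ be the horizon, $0\le V_T\le T$ and $S_T\in\{1,\dots,T\}$. There are infinitely many arms $a\in\mathcal A$ with i.i.d. initial mean rewards $\mu_1(a)\in[0,1]$ such that $$c_{\mathrm{lo}}\,x^\beta\le \mathbb P(\mu_1(a)>1-x)\le c_{\mathrm{hi}}\,x^\beta\qquad\text{for all }x\in[0,1].$$ In round $t=1,2,\dots,T$ an arm $a_t$ is pulled and the reward $r_t=\mu_t(a_t)+\eta_t$ is observed, where $\eta_t$ is $1$-sub-Gaussian conditionally on the initial means and on everything that happened before round $t$. An adaptive adversary then chooses $\rho_t\ge 0$ on the basis of everything that has happened so far (the initial means included), and the means are updated by $\mu_{t+1}(a_t)=\mu_t(a_t)-\rho_t$ and $\mu_{t+1}(a)=\mu_t(a)$ for $a\ne a_t$. The adversary satisfies both $$\sum_{t=1}^{T-1}\rho_t\le V_T\qquad\text{and}\qquad 1+\sum_{t=1}^{T-1}\mathbf 1(\rho_t\ne 0)\le S_T .$$ **Algorithm with threshold parameter $\delta$.** New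 arms are taken one after the other from a sequence of distinct arms fixed in advance. The first arm is selected and pulled in round $1$. In round $t=2,\dots,T$ let $a$ be the arm pulled in round $t-1$ and $t(a)$ the round in which it was selected. If $$\min_{s}\ \bigl(\widehat\mu_{[s,t-1]}(a)+\sqrt{12\log(T)/n_{[s,t-1]}(a)}\bigr)<1-\delta ,$$ where $s$ runs over the integers of the form $s=t-2^{i}$, $i\in\{0,1,2,\dots\}$, with $t(a)\le s\le t-1$, then $a$ is withdrawn for good and a new arm is selected and pulled; otherwise $a$ is pulled again. Here $n_{[s,t-1]}(a)$ is the number of pulls of $a$ in the rounds $s,\dots,t-1$ and $\widehat\mu_{[s,t-1]}(a)$ is the average of the rewards of these pulls. **Parameters and rates.** Put $$\delta_V=\begin{cases}c_1\max\{(V_T/T)^{\frac1{\beta+2}},T^{-\frac1{\beta+1}}\}&\beta\ge1\\ c_1\max\{(V_T/T)^{\frac13},T^{-\frac12}\}&0<\beta<1\end{cases}\qquad \delta_S=\begin{cases}c_1(S_T/T)^{\frac1{\beta+1}}&\beta\ge 1\\ c_1(S_T/T)^{\frac12}&0<\beta<1\end{cases}$$ $$R_V=\begin{cases}\max\{V_T^{\frac1{\beta+2}}T^{\frac{\beta+1}{\beta+2}},T^{\frac{\beta}{\beta+1}}\}&\beta\ge1\\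 \max\{V_T^{\frac13}T^{\frac23},\sqrt T\}&0<\beta<1\end{cases}\qquad R_S=\begin{cases}\max\{S_T^{\frac1{\beta+1}}T^{\frac\beta{\beta+1}},V_T\}&\beta\ge1\\ \max\{\sqrt{S_TT},V_T\}&0<\beta<1.\end{cases}$$ **Claim.** The algorithm with $\delta=\min\{\delta_V,\delta_S\}$ has expected regret $$\mathbb E\Bigl[\sum_{t=1}^T(1-\mu_t(a_t))\Bigr]=\tilde O(\min\{R_V,R_S\}).$$ That is, there are $C>0$ and $k\in\mathbb N$, depending only on $\beta,c_1,c_{\mathrm{lo}},c_{\mathrm{hi}}$, such that for all $T,V_T,S_T$ and all environments as above the regret is integrable and its expectation is at most $C(1+\log T)^k\min\{R_V,R_S\}$. -/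

import Mathlib

open MeasureTheory ProbabilityTheory Finset

namespace RottingBandit

noncomputable section

open scoped Classical

universe u v

variable {𝒜 : Type u} {Ω : Type v}

/-! ### The window-UCB index -/

/-- `n_{[t₁,t₂]}(b)`: the number of pulls of arm `b` during the rounds `t₁, …, t₂`. -/
def pullCount (arm : ℕ → 𝒜) (b : 𝒜) (t₁ t₂ : ℕ) : ℕ :=
  ((Icc t₁ t₂).filter fun t => arm t = b).card

/-- `μ̂_{[t₁,t₂]}(b)`: the average reward collected from arm `b` during the rounds `t₁, …, t₂`. -/
def empMean (arm : ℕ → 𝒜) (rew : ℕ → ℝ) (b : 𝒜) (t₁ t₂ : ℕ) : ℝ :=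
  (∑ t ∈ Icc t₁ t₂, if arm t = b then rew t else 0) / (pullCount arm b t₁ t₂ : ℝ)

/-- `WUCB(b, t₁, t₂, T)`. -/
def wucb (T : ℕ) (arm : ℕ → 𝒜) (rew : ℕ → ℝ) (b : 𝒜) (t₁ t₂ : ℕ) : ℝ :=
  empMean arm rew b t₁ t₂ + √(12 * Real.log T / (pullCount arm b t₁ t₂ : ℝ))

/-- `𝒯_t(a)`, where `t₀ = t(a)` is the round in which the current arm was selected: the starting
rounds `s` of the windows `[s, t - 1]` whose lengths are powers of two. -/
def windowStarts (T t₀ t : ℕ) : Finset ℕ :=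
  (Icc 1 T).filter fun s => t₀ ≤ s ∧ s < t ∧ ∃ i : ℕ, s + 2 ^ i = t

/-! ### The interaction of the algorithm with the environment -/

/-- The situation between two rounds. -/
structure Config (𝒜 : Type u) where
  /-- position, in the order of selection, of the arm that is currently in use -/
  idx : ℕ
  /-- the round in which that arm was selected -/
  start : ℕ
  /-- the arms pulled in the past rounds (later entries carry no information) -/
  arm : ℕ → 𝒜
  /-- the rewards obtained in the past rounds (later entries carry no information) -/
  rew : ℕ → ℝ
  /-- the present mean rewards of all arms (not visible to the algorithm) -/
  mean : 𝒜 → ℝ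

/-- The threshold condition tested at the beginning of round `t`:
`min_{s ∈ 𝒯_t(a)} WUCB(a, s, t - 1, T) < 1 - δ` for the current arm `a`, written as the existence
of a window whose index is below the threshold. -/
def Withdraw (T : ℕ) (δ : ℝ) (sel : ℕ → 𝒜) (t : ℕ) (c : Config 𝒜) : Prop :=
  ∃ s ∈ windowStarts T c.start t, wucb T c.arm c.rew (sel c.idx) s (t - 1) < 1 - δ

/-- Position of the arm that the algorithm pulls in round `t`. -/
def nextIdx (T : ℕ) (δ : ℝ) (sel : ℕ → 𝒜) (t : ℕ) (c : Config 𝒜) : ℕ :=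
  if Withdraw T δ sel t c then c.idx + 1 else c.idx

/-- Round `t`: the algorithm keeps or replaces its arm, pulls it, and obtains the mean reward plus
the noise `η t`; then the mean reward of the pulled arm, and of no other arm, drops by `ρ t`. -/
def playRound (T : ℕ) (δ : ℝ) (sel : ℕ → 𝒜) (η ρ : ℕ → ℝ) (t : ℕ) (c : Config 𝒜) : Config 𝒜 where
  idx := nextIdx T δ sel t c
  start := if Withdraw T δ sel t c then t else c.start
  arm := Function.update c.arm t (sel (nextIdx T δ sel t c))
  rew := Function.update c.rew t (c.mean (sel (nextIdx T δ sel t c)) + η t)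
  mean := Function.update c.mean (sel (nextIdx T δ sel t c))
    (c.mean (sel (nextIdx T δ sel t c)) - ρ t)

/-- The situation after `t` rounds. New arms are taken in the order `sel 0, sel 1, …`; `m` gives
the initial mean rewards, `η t` and `ρ t` are the noise and the rotting rate of round `t ≥ 1`.
In round `1` there is no window to test, so that the arm `sel 0` is pulled. -/
def run (T : ℕ) (δ : ℝ) (sel : ℕ → 𝒜) (m : 𝒜 → ℝ) (η ρ : ℕ → ℝ) : ℕ → Config 𝒜
  | 0 => { idx := 0, start := 1, arm := fun _ => sel 0, rew := fun _ => 0, mean := m }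
  | t + 1 => playRound T δ sel η ρ (t + 1) (run T δ sel m η ρ t)

/-- The arm `a_t` pulled in round `t`. -/
def armAt (T : ℕ) (δ : ℝ) (sel : ℕ → 𝒜) (m : 𝒜 → ℝ) (η ρ : ℕ → ℝ) (t : ℕ) : 𝒜 :=
  (run T δ sel m η ρ t).arm t

/-- The mean reward `μ_t(b)` of arm `b` at the beginning of round `t ≥ 1`. -/
def meanAt (T : ℕ) (δ : ℝ) (sel : ℕ → 𝒜) (m : 𝒜 → ℝ) (η ρ : ℕ → ℝ) (t : ℕ) (b : 𝒜) : ℝ :=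
  (run T δ sel m η ρ (t - 1)).mean b

/-- The regret `R(T) = ∑_{t=1}^T (1 - μ_t(a_t))` of the algorithm with threshold parameter `δ`. -/
def regret (T : ℕ) (δ : ℝ) (sel : ℕ → 𝒜) (m : 𝒜 → ℝ) (η ρ : ℕ → ℝ) : ℝ :=
  ∑ t ∈ Icc 1 T, (1 - meanAt T δ sel m η ρ t (armAt T δ sel m η ρ t))

/-! ### The random environment -/

/-- The initial mean rewards are i.i.d. in `[0,1]`, and `ℙ(μ₁(a) > 1 - x) = Θ(x^β)` on `[0,1]`
with the constants `lo` and `hi`. -/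
structure InitialMeans [MeasurableSpace Ω] (P : Measure Ω) (β lo hi : ℝ) (μ₁ : 𝒜 → Ω → ℝ) :
    Prop where
  measurable : ∀ a, Measurable (μ₁ a)
  indep : iIndepFun μ₁ P
  identDistrib : ∀ a b, IdentDistrib (μ₁ a) (μ₁ b) P P
  mem_Icc : ∀ a, ∀ᵐ ω ∂P, μ₁ a ω ∈ Set.Icc (0 : ℝ) 1
  lower : ∀ a, ∀ x ∈ Set.Icc (0 : ℝ) 1, lo * x ^ β ≤ P.real {ω | 1 - x < μ₁ a ω}
  upper : ∀ a, ∀ x ∈ Set.Icc (0 : ℝ) 1, P.real {ω | 1 - x < μ₁ a ω} ≤ hi * x ^ β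

/-- The noise of each round is `1`-sub-Gaussian given everything that happened before it. -/
structure SubGaussianNoise [mΩ : MeasurableSpace Ω] (P : Measure Ω) (ℱ : Filtration ℕ mΩ)
    (η : ℕ → Ω → ℝ) : Prop where
  adapted : ∀ t, Measurable[ℱ t] (η t)
  integrable_exp : ∀ (t : ℕ) (z : ℝ), Integrable (fun ω => Real.exp (z * η (t + 1) ω)) P
  condExp_exp_le : ∀ (t : ℕ) (z : ℝ),
    P[fun ω => Real.exp (z * η (t + 1) ω) | ℱ t] ≤ᵐ[P] fun _ => Real.exp (z ^ 2 / 2)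

/-- An adaptive adversary that satisfies both the slow and the abrupt rotting constraint: the rate
`ρ t ≥ 0` is chosen after the pull of round `t` from the information available by then. -/
structure AdaptiveAdversary [mΩ : MeasurableSpace Ω] (P : Measure Ω) (ℱ : Filtration ℕ mΩ)
    (T : ℕ) (V : ℝ) (S : ℕ) (ρ : ℕ → Ω → ℝ) : Prop where
  adapted : ∀ t, Measurable[ℱ t] (ρ t)
  nonneg : ∀ t, ∀ᵐ ω ∂P, 0 ≤ ρ t ω
  slow : ∀ᵐ ω ∂P, ∑ t ∈ Ico 1 T, ρ t ω ≤ V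
  abrupt : ∀ᵐ ω ∂P, 1 + ((Ico 1 T).filter fun t => ρ t ω ≠ 0).card ≤ S

/-! ### Tuning parameters and rates -/

/-- `δ_V(β)`. -/
def deltaV (c₁ β V : ℝ) (T : ℕ) : ℝ :=
  if 1 ≤ β then c₁ * max ((V / T) ^ (1 / (β + 2))) (1 / (T : ℝ) ^ (1 / (β + 1)))
  else c₁ * max ((V / T) ^ (1 / 3 : ℝ)) (1 / √(T : ℝ))

/-- `δ_S(β)`. -/
def deltaS (c₁ β : ℝ) (S T : ℕ) : ℝ :=
  if 1 ≤ β then c₁ * ((S : ℝ) / T) ^ (1 / (β + 1)) else c₁ * ((S : ℝ) / T) ^ (1 / 2 : ℝ)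

/-- `R_V`. -/
def rateV (β V : ℝ) (T : ℕ) : ℝ :=
  if 1 ≤ β then
    max (V ^ (1 / (β + 2)) * (T : ℝ) ^ ((β + 1) / (β + 2))) ((T : ℝ) ^ (β / (β + 1)))
  else max (V ^ (1 / 3 : ℝ) * (T : ℝ) ^ (2 / 3 : ℝ)) √(T : ℝ)

/-- `R_S`. -/
def rateS (β V : ℝ) (S T : ℕ) : ℝ :=
  if 1 ≤ β then max ((S : ℝ) ^ (1 / (β + 1)) * (T : ℝ) ^ (β / (β + 1))) V
  else max √((S : ℝ) * T) V

end

end RottingBandit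

/-!
Suppose that the noise stays within the confidence width on all windows. Then an arm is replaced
only when its gap `1 - μ` exceeds `δ`, and as long as an arm is kept, its average gap over windows
of dyadic length is at most `δ` up to the confidence width; gaps only grow while an arm is in use,
so an arm of initial gap `Δ` costs at most `2δ` per round plus `O(log T / max Δ δ)`. A replaced arm
with `Δ < δ/2` has lost more than `δ/2` to rotting, so fewer than `M` such arms are replaced if
`M > 2V/δ` or `M ≥ S`. As a fresh arm has `Δ < δ/2` with probability at least of order `δ^β`, and
`1 / max Δ δ` has expectation `O(δ^(β - max β 1) log (1/δ))`, Wald's identity bounds the expected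
cost of the arms tried by `M δ^(-max β 1)` up to logarithms. The total `δT + M δ^(-max β 1) + V` is
of the order of the claimed rate at `δ = min δ_V δ_S`.
-/

namespace RottingBandit

noncomputable section

open scoped Classical

universe u v

variable {𝒜 : Type u} {Ω : Type v}

/-! ### Sums over dyadic windows -/

theorem sqrt_add_four_mul_sqrt_le {x y : ℝ} (hy : 0 ≤ y) (hyx : y ≤ x) :
    √x + 4 * √y ≤ 4 * √(x + y) := by
  have hx : 0 ≤ x := hy.trans hyx
  refine (abs_le_of_sq_le_sq' ?_ (by positivity)).2
  nlinarith [Real.sq_sqrt hx, Real.sq_sqrt hy, Real.sq_sqrt (add_nonneg hx hy),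
    Real.sqrt_nonneg y, Real.sqrt_le_sqrt hyx]

-- Peel off the longest dyadic prefix of the block; what remains is at most as long as the prefix.
theorem sum_Ico_le_of_dyadic_windows {g : ℕ → ℝ} {δ κ : ℝ} (hκ : 0 ≤ κ) (n a : ℕ)
    (h : ∀ s i, a ≤ s → s + 2 ^ i ≤ a + n →
      ∑ u ∈ Ico s (s + 2 ^ i), g u ≤ δ * 2 ^ i + κ * √(2 ^ i)) :
    ∑ u ∈ Ico a (a + n), g u ≤ δ * n + 4 * κ * √n := by
  induction n using Nat.strong_induction_on generalizing a with
  | _ n ih =>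
    rcases Nat.eq_zero_or_pos n with rfl | hn
    · simp
    have hle : 2 ^ Nat.log 2 n ≤ n := Nat.pow_log_le_self 2 hn.ne'
    have hlt : n < 2 ^ (Nat.log 2 n + 1) := Nat.lt_pow_succ_log_self (by norm_num) n
    generalize Nat.log 2 n = i at hle hlt
    obtain ⟨r, rfl⟩ := Nat.exists_eq_add_of_le hle
    have hr : r ≤ 2 ^ i := by rw [pow_succ] at hlt; omega
    have : 0 < 2 ^ i := by positivity
    have hprefix := h a i le_rfl (by omega)
    have hrest := ih r (by omega) (a + 2 ^ i) fun s j hs hj => h s j (by omega) (by omega)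
    have hsqrt := mul_le_mul_of_nonneg_left
      (sqrt_add_four_mul_sqrt_le (x := 2 ^ i) r.cast_nonneg (by exact_mod_cast hr)) hκ
    rw [← add_assoc, ← sum_Ico_consecutive g (Nat.le_add_right a (2 ^ i)) (Nat.le_add_right _ r)]
    push_cast
    linarith

-- By AM-GM, `4κx ≤ yx²/2 + 8κ²/y` with `y = max Δ δ`; for `y = Δ` the term `yx²/2` is at most
-- `s/2`.
theorem le_of_le_add_mul_of_mul_sq_le {δ κ Δ x s : ℝ} (hδ : 0 < δ)
    (hs : s ≤ δ * x ^ 2 + 4 * κ * x) (hΔ : Δ * x ^ 2 ≤ s) :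
    s ≤ 2 * δ * x ^ 2 + 16 * κ ^ 2 / max Δ δ := by
  have amgm : ∀ y : ℝ, 0 < y → 4 * κ * x ≤ y * x ^ 2 / 2 + 8 * κ ^ 2 / y := fun y hy => by
    have : y * x ^ 2 / 2 + 8 * κ ^ 2 / y - 4 * κ * x = (y * x - 4 * κ) ^ 2 / (2 * y) := by
      field_simp
      ring
    have : 0 ≤ (y * x - 4 * κ) ^ 2 / (2 * y) := by positivity
    linarith
  rcases le_total Δ δ with h | h
  · have hdouble : 8 * κ ^ 2 / δ ≤ 16 * κ ^ 2 / δ := by gcongr; norm_num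
    rw [max_eq_right h]
    nlinarith [amgm δ hδ, sq_nonneg x]
  · have hdouble : 16 * κ ^ 2 / Δ = 2 * (8 * κ ^ 2 / Δ) := by ring
    rw [max_eq_left h]
    linarith [amgm Δ (hδ.trans_le h)]

theorem sum_Ico_le_of_dyadic_windows_of_le {g : ℕ → ℝ} {δ κ Δ : ℝ} (hκ : 0 ≤ κ) (hδ : 0 < δ)
    (n a : ℕ)
    (h : ∀ s i, a ≤ s → s + 2 ^ i ≤ a + n →
      ∑ u ∈ Ico s (s + 2 ^ i), g u ≤ δ * 2 ^ i + κ * √(2 ^ i))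
    (hΔ : ∀ u ∈ Ico a (a + n), Δ ≤ g u) :
    ∑ u ∈ Ico a (a + n), g u ≤ 2 * δ * n + 16 * κ ^ 2 / max Δ δ := by
  have hn : √(n : ℝ) ^ 2 = n := Real.sq_sqrt n.cast_nonneg
  have hlow : Δ * n ≤ ∑ u ∈ Ico a (a + n), g u := by
    simpa [mul_comm] using card_nsmul_le_sum _ _ _ hΔ
  have hup := sum_Ico_le_of_dyadic_windows hκ n a h
  rw [← hn] at hlow ⊢
  exact le_of_le_add_mul_of_mul_sq_le hδ (by rwa [hn]) hlow

/-! ### Gap sequences of a threshold policy -/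

theorem exists_filter_eq_Icc_of_monotoneOn {f : ℕ → ℕ} {m n k : ℕ}
    (hf : MonotoneOn f (Set.Icc m n)) (hne : ((Icc m n).filter fun t => f t = k).Nonempty) :
    ∃ a b, a ≤ b ∧ (Icc m n).filter (fun t => f t = k) = Icc a b := by
  have hmin := mem_filter.1 (min'_mem _ hne)
  have hmax := mem_filter.1 (max'_mem _ hne)
  refine ⟨_, _, min'_le_max' _ hne, ext fun t => ⟨fun ht =>
    mem_Icc.2 ⟨min'_le _ t ht, le_max' _ t ht⟩, fun ht => ?_⟩⟩
  rw [mem_Icc] at hmin hmax ht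
  have htmn : t ∈ Set.Icc m n := ⟨hmin.1.1.trans ht.1, ht.2.trans hmax.1.2⟩
  exact mem_filter.2 ⟨mem_Icc.2 htmn, le_antisymm
    ((hf htmn hmax.1 ht.2).trans_eq hmax.2) (hmin.2.symm.trans_le (hf hmin.1 htmn ht.1))⟩

/-- The path of a threshold policy that uses the arms one after the other, seen through gaps
`1 - μ`: `I t` is the position of the arm in use in round `t`, `g t` its gap, `Δ k` the initial gap
of the arm at position `k`, and `ρ t` the rotting rate. The fields `keep` and `drop` record what the
test yields on a well-behaved noise sequence: windows of dyadic length that end before the arm's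
last round have average gap at most `δ` up to a deviation controlled by `κ`, and only arms of gap
larger than `δ` are replaced. -/
structure ThresholdPath (T : ℕ) (δ κ : ℝ) (I : ℕ → ℕ) (g Δ ρ : ℕ → ℝ) : Prop where
  rotting_nonneg : ∀ t, 0 ≤ ρ t
  one : I 1 = 0
  step : ∀ t, 1 ≤ t → I (t + 1) = I t ∨ I (t + 1) = I t + 1
  gap : ∀ t, 1 ≤ t → g t = Δ (I t) + ∑ u ∈ Ico 1 t with I u = I t, ρ u
  keep : ∀ s i, 1 ≤ s → s + 2 ^ i ≤ T → I s = I (s + 2 ^ i) →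
    ∑ u ∈ Ico s (s + 2 ^ i), g u ≤ δ * 2 ^ i + κ * √(2 ^ i)
  drop : ∀ t, 1 ≤ t → t < T → I (t + 1) = I t + 1 → δ < g t

namespace ThresholdPath

variable {T : ℕ} {δ κ : ℝ} {I : ℕ → ℕ} {g Δ ρ : ℕ → ℝ}

theorem mono (h : ThresholdPath T δ κ I g Δ ρ) {s t : ℕ} (hs : 1 ≤ s) (hst : s ≤ t) :
    I s ≤ I t := by
  induction t, hst using Nat.le_induction with
  | base => exact le_rfl
  | succ t ht ih => rcases h.step t (by omega) with e | e <;> omega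

theorem lt (h : ThresholdPath T δ κ I g Δ ρ) {t : ℕ} (ht : 1 ≤ t) : I t < t := by
  induction t, ht using Nat.le_induction with
  | base => rw [h.one]; norm_num
  | succ t ht ih => rcases h.step t (by omega) with e | e <;> omega

theorem exists_last_round (h : ThresholdPath T δ κ I g Δ ρ) {k t : ℕ} (ht : 1 ≤ t) (hk : k < I t) :
    ∃ s, 1 ≤ s ∧ s < t ∧ I s = k ∧ I (s + 1) = I s + 1 := by
  induction t, ht using Nat.le_induction with
  | base => rw [h.one] at hk; omega
  | succ t ht ih =>
    by_cases hk' : k < I t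
    · obtain ⟨s, hs, hst, hI⟩ := ih hk'
      exact ⟨s, hs, by omega, hI⟩
    · rcases h.step t ht with e | e
      · omega
      · exact ⟨t, ht, by omega, by omega, e⟩

theorem initialGap_le (h : ThresholdPath T δ κ I g Δ ρ) {t : ℕ} (ht : 1 ≤ t) :
    Δ (I t) ≤ g t := by
  rw [h.gap t ht]
  exact le_add_of_nonneg_right (sum_nonneg fun u _ => h.rotting_nonneg u)

theorem gap_le (h : ThresholdPath T δ κ I g Δ ρ) {t : ℕ} (ht : 1 ≤ t) (htT : t ≤ T) :
    g t ≤ Δ (I t) + ∑ u ∈ Ico 1 T with I u = I t, ρ u := by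
  rw [h.gap t ht]
  exact add_le_add_right (sum_le_sum_of_subset_of_nonneg
    (filter_subset_filter _ (Ico_subset_Ico_right htT)) fun u _ _ => h.rotting_nonneg u) _

theorem sum_gap_of_arm_le (h : ThresholdPath T δ κ I g Δ ρ) (hκ : 0 ≤ κ) (hδ : 0 < δ) {k : ℕ}
    (hΔ : Δ k ≤ 1) :
    ∑ u ∈ Icc 1 T with I u = k, g u ≤
      2 * δ * (#{u ∈ Icc 1 T | I u = k} : ℝ) + (16 * κ ^ 2 + 1) * (1 / max (Δ k) δ) +
        ∑ u ∈ Ico 1 T with I u = k, ρ u := by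
  have : 0 < max (Δ k) δ := lt_max_of_lt_right hδ
  rcases ((Icc 1 T).filter fun u => I u = k).eq_empty_or_nonempty with hempty | hne
  · rw [hempty, sum_empty, card_empty]
    have := sum_nonneg fun u (_ : u ∈ (Ico 1 T).filter fun u => I u = k) => h.rotting_nonneg u
    positivity
  obtain ⟨a, b, hab, hfiber⟩ := exists_filter_eq_Icc_of_monotoneOn
    (fun s hs t _ hst => h.mono hs.1 hst) hne
  obtain ⟨n, rfl⟩ := Nat.exists_eq_add_of_le hab
  have hmem : ∀ u, a ≤ u → u ≤ a + n → (1 ≤ u ∧ u ≤ T) ∧ I u = k := fun u hau hub => by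
    have hu := mem_Icc.2 ⟨hau, hub⟩
    rwa [← hfiber, mem_filter, mem_Icc] at hu
  have hblock := sum_Ico_le_of_dyadic_windows_of_le (g := g) (Δ := Δ k) hκ hδ n a
    (fun s i hs hi => by
      have hend := hmem (s + 2 ^ i) (hs.trans (Nat.le_add_right _ _)) hi
      have hstart := hmem s hs ((Nat.le_add_right _ _).trans hi)
      exact h.keep s i hstart.1.1 hend.1.2 (hstart.2.trans hend.2.symm))
    (fun u hu => by
      obtain ⟨hu1, hIu⟩ := hmem u (mem_Ico.1 hu).1 (mem_Ico.1 hu).2.le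
      exact hIu ▸ h.initialGap_le hu1.1)
  have hlast := h.gap_le (hmem _ hab le_rfl).1.1 (hmem _ hab le_rfl).1.2
  rw [(hmem _ hab le_rfl).2] at hlast
  have hinitial : Δ k ≤ δ + 1 / max (Δ k) δ := by
    rcases le_total (Δ k) δ with hle | hle
    · exact hle.trans (le_add_of_nonneg_right (by positivity))
    · rw [max_eq_left hle]
      exact hΔ.trans (((one_le_div (hδ.trans_le hle)).2 hΔ).trans (le_add_of_nonneg_left hδ.le))
  rw [hfiber, ← sum_Ico_add_eq_sum_Icc hab, Nat.card_Icc, show a + n + 1 - a = n + 1 by omega]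
  push_cast
  rw [div_eq_mul_one_div] at hblock
  linarith

theorem sum_gap_le (h : ThresholdPath T δ κ I g Δ ρ) (hκ : 0 ≤ κ) (hδ : 0 < δ)
    (hΔ : ∀ k, Δ k ≤ 1) :
    ∑ u ∈ Icc 1 T, g u ≤
      2 * δ * T + (16 * κ ^ 2 + 1) * (∑ k ∈ range (I T + 1), 1 / max (Δ k) δ) +
        ∑ u ∈ Ico 1 T, ρ u := by
  have hmaps : ∀ u ∈ Icc 1 T, I u ∈ range (I T + 1) := fun u hu =>
    mem_range_succ_iff.2 (h.mono (mem_Icc.1 hu).1 (mem_Icc.1 hu).2)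
  have hmaps' : ∀ u ∈ Ico 1 T, I u ∈ range (I T + 1) := fun u hu =>
    hmaps u (Ico_subset_Icc_self hu)
  have hcard : (T : ℝ) = ∑ k ∈ range (I T + 1), (#{u ∈ Icc 1 T | I u = k} : ℝ) := by
    rw [← Nat.cast_sum, ← card_eq_sum_card_fiberwise hmaps, Nat.card_Icc, Nat.add_sub_cancel]
  rw [← sum_fiberwise_of_maps_to hmaps g, ← sum_fiberwise_of_maps_to hmaps' ρ]
  conv_rhs => rw [hcard]
  rw [mul_sum, mul_sum, ← sum_add_distrib, ← sum_add_distrib]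
  exact sum_le_sum fun k _ => h.sum_gap_of_arm_le hκ hδ (hΔ k)

theorem rotting_of_replaced_arm (h : ThresholdPath T δ κ I g Δ ρ) (hT : 1 ≤ T) {k : ℕ}
    (hk : k < I T) (hΔ : Δ k < δ / 2) : δ / 2 < ∑ u ∈ Ico 1 T with I u = k, ρ u := by
  obtain ⟨s, hs, hsT, rfl, hdrop⟩ := h.exists_last_round hT hk
  linarith [h.drop s hs hsT hdrop, h.gap_le hs hsT.le]

theorem card_replaced_lt_of_slow (h : ThresholdPath T δ κ I g Δ ρ) (hδ : 0 < δ) (hT : 1 ≤ T)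
    {V : ℝ} (hV : ∑ u ∈ Ico 1 T, ρ u ≤ V) {M : ℕ} (hM : 2 * V / δ < M) :
    #{k ∈ range (I T) | Δ k < δ / 2} < M := by
  set G := (range (I T)).filter fun k => Δ k < δ / 2 with hG
  have hbudget : (#G : ℝ) * (δ / 2) ≤ V :=
    calc (#G : ℝ) * (δ / 2) ≤ ∑ k ∈ G, ∑ u ∈ Ico 1 T with I u = k, ρ u := by
          rw [← nsmul_eq_mul]
          refine card_nsmul_le_sum _ _ _ fun k hk => ?_
          rw [hG, mem_filter, mem_range] at hk
          exact (h.rotting_of_replaced_arm hT hk.1 hk.2).le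
      _ ≤ ∑ u ∈ Ico 1 T, ρ u := sum_fiberwise_le_sum_of_sum_fiber_nonneg
          fun k _ => sum_nonneg fun u _ => h.rotting_nonneg u
      _ ≤ V := hV
  have hcard : (#G : ℝ) ≤ 2 * V / δ := by rw [le_div_iff₀ hδ]; linarith
  exact_mod_cast hcard.trans_lt hM

theorem card_replaced_le_of_abrupt (h : ThresholdPath T δ κ I g Δ ρ) (hδ : 0 < δ) (hT : 1 ≤ T) :
    #{k ∈ range (I T) | Δ k < δ / 2} ≤ #{t ∈ Ico 1 T | ρ t ≠ 0} := by
  refine (card_le_card fun k hk => ?_).trans (card_image_le (f := I))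
  rw [mem_filter, mem_range] at hk
  have hpos : 0 < ∑ u ∈ Ico 1 T with I u = k, ρ u :=
    (half_pos hδ).trans (h.rotting_of_replaced_arm hT hk.1 hk.2)
  obtain ⟨u, hu, hu0⟩ := exists_ne_zero_of_sum_ne_zero hpos.ne'
  rw [mem_filter] at hu
  exact mem_image.2 ⟨u, mem_filter.2 ⟨hu.1, hu0⟩, hu.2⟩

end ThresholdPath

/-! ### Runs of the algorithm -/

section Run

variable {T : ℕ} {δ : ℝ} {sel : ℕ → 𝒜} {m : 𝒜 → ℝ} {η ρ : ℕ → ℝ}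

/-- Position, in the order of selection, of the arm pulled in round `t`. -/
def idxAt (T : ℕ) (δ : ℝ) (sel : ℕ → 𝒜) (m : 𝒜 → ℝ) (η ρ : ℕ → ℝ) (t : ℕ) : ℕ :=
  (run T δ sel m η ρ t).idx

/-- The gap `1 - μ_t(a_t)` of the arm pulled in round `t`, at the beginning of that round. -/
def gapAt (T : ℕ) (δ : ℝ) (sel : ℕ → 𝒜) (m : 𝒜 → ℝ) (η ρ : ℕ → ℝ) (t : ℕ) : ℝ :=
  1 - (run T δ sel m η ρ (t - 1)).mean (sel (idxAt T δ sel m η ρ t))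

theorem idxAt_succ (t : ℕ) : idxAt T δ sel m η ρ (t + 1) =
    if Withdraw T δ sel (t + 1) (run T δ sel m η ρ t) then idxAt T δ sel m η ρ t + 1
    else idxAt T δ sel m η ρ t := rfl

theorem run_start_succ (t : ℕ) : (run T δ sel m η ρ (t + 1)).start =
    if Withdraw T δ sel (t + 1) (run T δ sel m η ρ t) then t + 1
    else (run T δ sel m η ρ t).start := rfl

theorem not_withdraw_one (c : Config 𝒜) : ¬ Withdraw T δ sel 1 c := by
  rintro ⟨s, hs, -⟩
  rw [windowStarts, mem_filter, mem_Icc] at hs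
  omega

theorem idxAt_one : idxAt T δ sel m η ρ 1 = 0 := by
  rw [idxAt_succ 0, if_neg (not_withdraw_one _)]
  rfl

theorem idxAt_mono : Monotone (idxAt T δ sel m η ρ) :=
  monotone_nat_of_le_succ fun t => by rw [idxAt_succ]; split_ifs <;> omega

theorem run_start_le (t : ℕ) : (run T δ sel m η ρ t).start ≤ max t 1 := by
  induction t with
  | zero => exact le_max_right _ _
  | succ t ih => rw [run_start_succ]; split_ifs <;> omega

theorem idxAt_eq_iff_start_le {s t : ℕ} (hs : 1 ≤ s) (hst : s ≤ t) :
    idxAt T δ sel m η ρ s = idxAt T δ sel m η ρ t ↔ (run T δ sel m η ρ t).start ≤ s := by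
  induction t, hst using Nat.le_induction with
  | base => simpa only [true_iff, max_eq_left hs] using run_start_le s
  | succ t ht ih =>
    have hmono := idxAt_mono (T := T) (δ := δ) (sel := sel) (m := m) (η := η) (ρ := ρ) ht
    rw [idxAt_succ, run_start_succ]
    split_ifs
    · omega
    · exact ih

theorem run_arm {t u : ℕ} (hu : 1 ≤ u) (hut : u ≤ t) :
    (run T δ sel m η ρ t).arm u = sel (idxAt T δ sel m η ρ u) := by
  induction t, hut using Nat.le_induction with
  | base =>
    obtain ⟨v, rfl⟩ := Nat.exists_eq_add_of_le' hu
    exact Function.update_self _ _ _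
  | succ t ht ih =>
    rw [← ih]
    exact Function.update_of_ne (by omega) _ _

theorem run_rew {t u : ℕ} (hu : 1 ≤ u) (hut : u ≤ t) :
    (run T δ sel m η ρ t).rew u = 1 - gapAt T δ sel m η ρ u + η u := by
  induction t, hut using Nat.le_induction with
  | base =>
    obtain ⟨v, rfl⟩ := Nat.exists_eq_add_of_le' hu
    rw [gapAt, sub_sub_cancel]
    exact Function.update_self _ _ _
  | succ t ht ih =>
    rw [← ih]
    exact Function.update_of_ne (by omega) _ _

theorem run_mean (hsel : Function.Injective sel) (t k : ℕ) :
    (run T δ sel m η ρ t).mean (sel k) =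
      m (sel k) - ∑ u ∈ Icc 1 t with idxAt T δ sel m η ρ u = k, ρ u := by
  induction t with
  | zero => simp [run]
  | succ t ih =>
    have hstep : (run T δ sel m η ρ (t + 1)).mean = Function.update (run T δ sel m η ρ t).mean
      (sel (idxAt T δ sel m η ρ (t + 1)))
      ((run T δ sel m η ρ t).mean (sel (idxAt T δ sel m η ρ (t + 1))) - ρ (t + 1)) := rfl
    rw [hstep, ← insert_Icc_right_eq_Icc_add_one (by omega), filter_insert]
    by_cases hk : idxAt T δ sel m η ρ (t + 1) = k
    · rw [if_pos hk, sum_insert (by simp), hk, Function.update_self, ih]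
      ring
    · rw [if_neg hk, Function.update_of_ne (fun h => hk (hsel h).symm), ih]

theorem regret_eq_sum_gapAt :
    regret T δ sel m η ρ = ∑ t ∈ Icc 1 T, gapAt T δ sel m η ρ t := by
  refine sum_congr rfl fun t ht => ?_
  rw [armAt, run_arm (mem_Icc.1 ht).1 le_rfl]
  rfl

theorem gapAt_eq (hsel : Function.Injective sel) {t : ℕ} (ht : 1 ≤ t) :
    gapAt T δ sel m η ρ t = (1 - m (sel (idxAt T δ sel m η ρ t))) +
      ∑ u ∈ Ico 1 t with idxAt T δ sel m η ρ u = idxAt T δ sel m η ρ t, ρ u := by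
  obtain ⟨v, rfl⟩ := Nat.exists_eq_add_of_le' ht
  rw [gapAt, run_mean hsel, Nat.add_sub_cancel, Ico_add_one_right_eq_Icc]
  ring

theorem gapAt_le_gapAt (hsel : Function.Injective sel) (hρ : ∀ t, 0 ≤ ρ t) {s t : ℕ} (hs : 1 ≤ s)
    (hst : s ≤ t) (hI : idxAt T δ sel m η ρ s = idxAt T δ sel m η ρ t) :
    gapAt T δ sel m η ρ s ≤ gapAt T δ sel m η ρ t := by
  rw [gapAt_eq hsel hs, gapAt_eq hsel (hs.trans hst), hI]
  exact add_le_add_right (sum_le_sum_of_subset_of_nonneg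
    (filter_subset_filter _ (Ico_subset_Ico_right hst)) fun u _ _ => hρ u) _

theorem empMean_run {s t : ℕ} (hs : 1 ≤ s) (hst : s ≤ t)
    (hstart : (run T δ sel m η ρ t).start ≤ s) :
    pullCount (run T δ sel m η ρ t).arm (sel (run T δ sel m η ρ t).idx) s t = t + 1 - s ∧
      empMean (run T δ sel m η ρ t).arm (run T δ sel m η ρ t).rew
          (sel (run T δ sel m η ρ t).idx) s t =
        1 - (∑ u ∈ Icc s t, gapAt T δ sel m η ρ u - ∑ u ∈ Icc s t, η u) / (t + 1 - s : ℕ) := by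
  have harm : ∀ u ∈ Icc s t,
      (run T δ sel m η ρ t).arm u = sel (run T δ sel m η ρ t).idx := fun u hu => by
    rw [mem_Icc] at hu
    rw [run_arm (hs.trans hu.1) hu.2,
      (idxAt_eq_iff_start_le (hs.trans hu.1) hu.2).2 (hstart.trans hu.1), idxAt]
  have hcount : pullCount (run T δ sel m η ρ t).arm (sel (run T δ sel m η ρ t).idx) s t =
      t + 1 - s := by
    rw [pullCount, filter_true_of_mem harm, Nat.card_Icc]
  have hrew : (∑ u ∈ Icc s t, if (run T δ sel m η ρ t).arm u = sel (run T δ sel m η ρ t).idx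
      then (run T δ sel m η ρ t).rew u else 0) =
      ∑ u ∈ Icc s t, (1 - gapAt T δ sel m η ρ u + η u) :=
    sum_congr rfl fun u hu => by
      rw [if_pos (harm u hu), run_rew (hs.trans (mem_Icc.1 hu).1) (mem_Icc.1 hu).2]
  have hpos : ((t + 1 - s : ℕ) : ℝ) ≠ 0 := Nat.cast_ne_zero.2 (by omega)
  refine ⟨hcount, ?_⟩
  rw [empMean, hcount, hrew, sum_add_distrib, sum_sub_distrib, sum_const, Nat.card_Icc,
    nsmul_eq_mul, mul_one]
  field_simp
  ring

theorem wucb_run_lt_iff {s t : ℕ} (hs : 1 ≤ s) (hst : s ≤ t)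
    (hstart : (run T δ sel m η ρ t).start ≤ s) :
    wucb T (run T δ sel m η ρ t).arm (run T δ sel m η ρ t).rew
        (sel (run T δ sel m η ρ t).idx) s t < 1 - δ ↔
      δ * (t + 1 - s : ℕ) + ∑ u ∈ Icc s t, η u + √(12 * Real.log T * (t + 1 - s : ℕ)) <
        ∑ u ∈ Icc s t, gapAt T δ sel m η ρ u := by
  obtain ⟨hcount, hmean⟩ := empMean_run (m := m) (η := η) (ρ := ρ) hs hst hstart
  rw [wucb, hmean, hcount]
  have hn : (0 : ℝ) < (t + 1 - s : ℕ) := Nat.cast_pos.2 (by omega)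
  generalize ((t + 1 - s : ℕ) : ℝ) = n at hn ⊢
  have hwidth : √(12 * Real.log T / n) = √(12 * Real.log T * n) / n := by
    rw [← Real.sqrt_sq hn.le, ← Real.sqrt_div' _ (sq_nonneg _), Real.sqrt_sq hn.le]
    congr 1
    field_simp
  rw [hwidth, sub_add, ← sub_div, sub_lt_sub_iff_left, lt_div_iff₀ hn, lt_sub_iff_add_lt,
    lt_sub_iff_add_lt, add_right_comm]

/-- The noise stays within the confidence width on every window up to the horizon. -/
def GoodNoise (T : ℕ) (η : ℕ → ℝ) : Prop :=
  ∀ s ∈ Icc 1 T, ∀ t ∈ Icc s T, |∑ u ∈ Icc s t, η u| ≤ √(12 * Real.log T * (t + 1 - s : ℕ))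

theorem sum_gapAt_le_of_goodNoise (hη : GoodNoise T η) {s i : ℕ} (hs : 1 ≤ s) (hsT : s + 2 ^ i ≤ T)
    (hI : idxAt T δ sel m η ρ s = idxAt T δ sel m η ρ (s + 2 ^ i)) :
    ∑ u ∈ Ico s (s + 2 ^ i), gapAt T δ sel m η ρ u ≤
      δ * 2 ^ i + 2 * √(12 * Real.log T) * √(2 ^ i) := by
  have hpos : 0 < 2 ^ i := by positivity
  obtain ⟨t, ht⟩ : ∃ t, s + 2 ^ i = t + 1 := ⟨s + 2 ^ i - 1, by omega⟩
  have hlen : t + 1 - s = 2 ^ i := by omega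
  rw [ht] at hI hsT ⊢
  have hst : s ≤ t := by omega
  have hkept : ¬ Withdraw T δ sel (t + 1) (run T δ sel m η ρ t) := fun hW => by
    have := idxAt_mono (T := T) (δ := δ) (sel := sel) (m := m) (η := η) (ρ := ρ) hst
    rw [idxAt_succ, if_pos hW] at hI
    omega
  rw [idxAt_succ, if_neg hkept] at hI
  have hstart := (idxAt_eq_iff_start_le hs hst).1 hI
  have hmem : s ∈ windowStarts T (run T δ sel m η ρ t).start (t + 1) := by
    rw [windowStarts, mem_filter, mem_Icc]
    exact ⟨by omega, hstart, by omega, i, ht⟩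
  have htest := mt (wucb_run_lt_iff hs hst hstart).2 fun hlt => hkept ⟨s, hmem, hlt⟩
  have hnoise := (abs_le.1 (hη s (mem_Icc.2 (by omega)) t (mem_Icc.2 (by omega)))).2
  rw [hlen, Real.sqrt_mul' _ (by positivity)] at htest hnoise
  push_cast at htest hnoise
  rw [Ico_add_one_right_eq_Icc]
  linarith

theorem lt_gapAt_of_goodNoise (hsel : Function.Injective sel) (hρ : ∀ t, 0 ≤ ρ t)
    (hη : GoodNoise T η) {t : ℕ} (htT : t < T)
    (hI : idxAt T δ sel m η ρ (t + 1) = idxAt T δ sel m η ρ t + 1) :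
    δ < gapAt T δ sel m η ρ t := by
  obtain ⟨s, hs, htest⟩ : Withdraw T δ sel (t + 1) (run T δ sel m η ρ t) := by
    by_contra hW
    rw [idxAt_succ, if_neg hW] at hI
    omega
  rw [windowStarts, mem_filter, mem_Icc] at hs
  obtain ⟨⟨hs1, -⟩, hstart, hst, -⟩ := hs
  have hst' : s ≤ t := by omega
  rw [Nat.add_sub_cancel] at htest
  have hlt := (wucb_run_lt_iff hs1 hst' hstart).1 htest
  have hnoise := (abs_le.1 (hη s (mem_Icc.2 (by omega)) t (mem_Icc.2 (by omega)))).1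
  have hsum : ∑ u ∈ Icc s t, gapAt T δ sel m η ρ u ≤
      (t + 1 - s : ℕ) * gapAt T δ sel m η ρ t := by
    rw [← Nat.card_Icc, ← nsmul_eq_mul]
    refine sum_le_card_nsmul _ _ _ fun u hu => ?_
    obtain ⟨hsu, hut⟩ := mem_Icc.1 hu
    exact gapAt_le_gapAt hsel hρ (hs1.trans hsu) hut
      ((idxAt_eq_iff_start_le (hs1.trans hsu) hut).2 (hstart.trans hsu))
  refine lt_of_mul_lt_mul_left (?_ : ((t + 1 - s : ℕ) : ℝ) * δ < _) (Nat.cast_nonneg _)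
  linarith

theorem thresholdPath_run (hsel : Function.Injective sel) (hρ : ∀ t, 0 ≤ ρ t)
    (hη : GoodNoise T η) :
    ThresholdPath T δ (2 * √(12 * Real.log T)) (idxAt T δ sel m η ρ) (gapAt T δ sel m η ρ)
      (fun k => 1 - m (sel k)) ρ where
  rotting_nonneg := hρ
  one := idxAt_one
  step t _ := by rw [idxAt_succ]; split_ifs <;> simp
  gap _ ht := gapAt_eq hsel ht
  keep _ _ hs hsT hI := sum_gapAt_le_of_goodNoise hη hs hsT hI
  drop _ _ htT hI := lt_gapAt_of_goodNoise hsel hρ hη htT hI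

end Run

/-! ### Concentration of the noise -/

theorem hasSubgaussianMGF_add_of_condExp_exp_le {m mΩ : MeasurableSpace Ω} {P : Measure Ω}
    [IsFiniteMeasure P] (hm : m ≤ mΩ) {X Y : Ω → ℝ} {a b : NNReal} (hXm : Measurable[m] X)
    (hX : HasSubgaussianMGF X a P) (hY : ∀ z : ℝ, Integrable (fun ω => Real.exp (z * Y ω)) P)
    (hcond : ∀ z : ℝ, P[fun ω => Real.exp (z * Y ω) | m] ≤ᵐ[P] fun _ => Real.exp (b * z ^ 2 / 2)) :
    HasSubgaussianMGF (fun ω => X ω + Y ω) (a + b) P := by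
  have hexp : ∀ z : ℝ, (fun ω => Real.exp (z * (X ω + Y ω))) =
      (fun ω => Real.exp (z * X ω)) * fun ω => Real.exp (z * Y ω) := fun z => by
    funext ω
    rw [mul_add, Real.exp_add, Pi.mul_apply]
  have hYsq : ∀ z : ℝ, MemLp (fun ω => Real.exp (z * Y ω)) 2 P := fun z =>
    (memLp_two_iff_integrable_sq (hY z).aestronglyMeasurable).2 <|
      (hY (2 * z)).congr <| .of_forall fun ω => by
        simp only [← Real.exp_nat_mul, Nat.cast_ofNat, mul_assoc]
  have hint : ∀ z : ℝ, Integrable ((fun ω => Real.exp (z * X ω)) * fun ω => Real.exp (z * Y ω)) P :=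
    fun z => (by simpa using hX.memLp_exp_mul z 2 : MemLp _ 2 P).integrable_mul (hYsq z)
  refine ⟨fun z => hexp z ▸ hint z, fun z => ?_⟩
  have hpull := condExp_mul_of_stronglyMeasurable_left (m := m)
    (Real.measurable_exp.comp (hXm.const_mul z)).stronglyMeasurable (hint z) (hY z)
  calc mgf (fun ω => X ω + Y ω) P z
      = ∫ ω, P[(fun ω => Real.exp (z * X ω)) * fun ω => Real.exp (z * Y ω) | m] ω ∂P := by
        rw [integral_condExp hm, ← hexp, mgf]
    _ ≤ ∫ ω, Real.exp (z * X ω) * Real.exp (b * z ^ 2 / 2) ∂P := by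
        refine integral_mono_ae integrable_condExp ((hX.integrable_exp_mul z).mul_const _) ?_
        filter_upwards [hpull, hcond z] with ω hpull hcond
        exact hpull.trans_le (mul_le_mul_of_nonneg_left hcond (Real.exp_pos _).le)
    _ = mgf X P z * Real.exp (b * z ^ 2 / 2) := integral_mul_const _ _
    _ ≤ Real.exp (a * z ^ 2 / 2) * Real.exp (b * z ^ 2 / 2) :=
        mul_le_mul_of_nonneg_right (hX.mgf_le z) (Real.exp_pos _).le
    _ = Real.exp ((a + b : NNReal) * z ^ 2 / 2) := by
        rw [← Real.exp_add, NNReal.coe_add]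
        ring_nf

theorem measureReal_lt_abs_le_of_hasSubgaussianMGF [MeasurableSpace Ω] {P : Measure Ω}
    [IsFiniteMeasure P] {X : Ω → ℝ} {c : NNReal} (hX : HasSubgaussianMGF X c P) {ε : ℝ}
    (hε : 0 ≤ ε) : P.real {ω | ε < |X ω|} ≤ 2 * Real.exp (-ε ^ 2 / (2 * c)) :=
  calc P.real {ω | ε < |X ω|} ≤ P.real ({ω | ε ≤ X ω} ∪ {ω | ε ≤ (-X) ω}) :=
        measureReal_mono fun ω hω =>
          (lt_abs.1 hω).imp (fun h => show ε ≤ X ω from h.le) fun h => show ε ≤ -X ω from h.le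
    _ ≤ P.real {ω | ε ≤ X ω} + P.real {ω | ε ≤ (-X) ω} := measureReal_union_le _ _
    _ ≤ 2 * Real.exp (-ε ^ 2 / (2 * c)) := by
        linarith [hX.measure_ge_le hε, hX.neg.measure_ge_le hε]

namespace SubGaussianNoise

variable [mΩ : MeasurableSpace Ω] {P : Measure Ω} {ℱ : Filtration ℕ mΩ} {η : ℕ → Ω → ℝ}

theorem measurable (h : SubGaussianNoise P ℱ η) (t : ℕ) : Measurable (η t) :=
  (h.adapted t).mono (ℱ.le t) le_rfl

theorem measurableSet_goodNoise (h : SubGaussianNoise P ℱ η) (T : ℕ) :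
    MeasurableSet {ω | GoodNoise T fun t => η t ω} := by
  simp only [GoodNoise, Set.ofPred_forall]
  exact Finset.measurableSet_biInter _ fun s _ => Finset.measurableSet_biInter _ fun t _ =>
    measurableSet_le (Finset.measurable_sum _ fun u _ => h.measurable u).abs measurable_const

variable [IsProbabilityMeasure P]

theorem hasSubgaussianMGF_sum (h : SubGaussianNoise P ℱ η) (r n : ℕ) :
    HasSubgaussianMGF (fun ω => ∑ u ∈ Ioc r (r + n), η u ω) n P := by
  induction n with
  | zero => simp
  | succ n ih =>
    have hpast : Measurable[ℱ (r + n)] fun ω => ∑ u ∈ Ioc r (r + n), η u ω :=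
      Finset.measurable_sum _ fun u hu =>
        (h.adapted u).mono (ℱ.mono (mem_Ioc.1 hu).2) le_rfl
    have hsucc := hasSubgaussianMGF_add_of_condExp_exp_le (b := 1) (ℱ.le (r + n)) hpast ih
      (h.integrable_exp (r + n)) (by simpa using h.condExp_exp_le (r + n))
    simpa only [← add_assoc, Nat.cast_add, Nat.cast_one,
      sum_Ioc_succ_top (Nat.le_add_right r n)] using hsucc

theorem measureReal_lt_abs_sum_le (h : SubGaussianNoise P ℱ η) {s t : ℕ} (hs : 1 ≤ s)
    (hst : s ≤ t) {L : ℝ} (hL : 0 ≤ L) :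
    P.real {ω | √(12 * L * (t + 1 - s : ℕ)) < |∑ u ∈ Icc s t, η u ω|} ≤
      2 * Real.exp (-(6 * L)) := by
  obtain ⟨r, rfl⟩ := Nat.exists_eq_add_of_le' hs
  obtain ⟨n, rfl⟩ := Nat.exists_eq_add_of_le hst
  have hlen : r + 1 + n + 1 - (r + 1) = n + 1 := by omega
  have htail := measureReal_lt_abs_le_of_hasSubgaussianMGF (h.hasSubgaussianMGF_sum r (n + 1))
    (Real.sqrt_nonneg (12 * L * (n + 1 : ℕ)))
  rw [Real.sq_sqrt (by positivity)] at htail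
  rw [hlen, Icc_add_one_left_eq_Ioc, show r + 1 + n = r + (n + 1) by omega]
  convert htail using 3
  push_cast
  field_simp
  ring

theorem measureReal_not_goodNoise_le (h : SubGaussianNoise P ℱ η) {T : ℕ} (hT : 1 ≤ T) :
    P.real {ω | ¬ GoodNoise T fun t => η t ω} ≤ 2 / (T : ℝ) ^ 4 := by
  have hunion : {ω | ¬ GoodNoise T fun t => η t ω} = ⋃ s ∈ Icc 1 T, ⋃ t ∈ Icc s T,
      {ω | √(12 * Real.log T * (t + 1 - s : ℕ)) < |∑ u ∈ Icc s t, η u ω|} := by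
    ext ω
    simp only [GoodNoise, Set.mem_ofPred_eq, Set.mem_iUnion, not_forall, not_le, exists_prop]
  have hT0 : (0 : ℝ) < T := by exact_mod_cast hT
  have hexp : Real.exp (-(6 * Real.log T)) = ((T : ℝ) ^ 6)⁻¹ := by
    rw [Real.exp_neg, ← Nat.cast_ofNat (n := 6), Real.exp_nat_mul, Real.exp_log hT0]
  have hwindows : ∀ s ∈ Icc 1 T, P.real (⋃ t ∈ Icc s T,
      {ω | √(12 * Real.log T * (t + 1 - s : ℕ)) < |∑ u ∈ Icc s t, η u ω|}) ≤
        T * (2 * Real.exp (-(6 * Real.log T))) := fun s hs => by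
    rw [mem_Icc] at hs
    refine (measureReal_biUnion_finset_le _ _).trans ((sum_le_card_nsmul _ _ _ fun t ht =>
      h.measureReal_lt_abs_sum_le hs.1 (mem_Icc.1 ht).1 (Real.log_natCast_nonneg T)).trans ?_)
    rw [nsmul_eq_mul, Nat.card_Icc]
    gcongr
    omega
  calc P.real {ω | ¬ GoodNoise T fun t => η t ω}
      ≤ #(Icc 1 T) • (T * (2 * Real.exp (-(6 * Real.log T)))) := by
        rw [hunion]
        exact (measureReal_biUnion_finset_le _ _).trans (sum_le_card_nsmul _ _ _ hwindows)
    _ = 2 / (T : ℝ) ^ 4 := by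
        rw [Nat.card_Icc, Nat.add_sub_cancel, nsmul_eq_mul, hexp]
        field_simp

end SubGaussianNoise

/-! ### Measurability of the regret -/

section Measurability

variable [MeasurableSpace Ω]

theorem measurable_eval_nat {E : Type*} [MeasurableSpace E] {f : ℕ → Ω → E} {n : Ω → ℕ}
    (hf : ∀ k, Measurable (f k)) (hn : Measurable n) : Measurable fun ω => f (n ω) ω :=
  (measurable_from_prod_countable_left (f := fun p : Ω × ℕ => f p.2 p.1) hf).comp
    (measurable_id.prodMk hn)

/-- A random configuration all of whose data are measurable. The arms carry no `σ`-algebra: for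
the pulled arms, the events `{arm u = b}` are required to be measurable instead. -/
structure MeasurableConfig (c : Ω → Config 𝒜) : Prop where
  idx : Measurable fun ω => (c ω).idx
  start : Measurable fun ω => (c ω).start
  arm : ∀ u b, MeasurableSet {ω | (c ω).arm u = b}
  rew : ∀ u, Measurable fun ω => (c ω).rew u
  mean : ∀ b, Measurable fun ω => (c ω).mean b

namespace MeasurableConfig

variable {c : Ω → Config 𝒜}

theorem measurable_wucb (h : MeasurableConfig c) (T : ℕ) (b : 𝒜) (t₁ t₂ : ℕ) :
    Measurable fun ω => wucb T (c ω).arm (c ω).rew b t₁ t₂ := by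
  have hcount : Measurable fun ω => (pullCount (c ω).arm b t₁ t₂ : ℝ) := by
    simp only [pullCount, card_filter, Nat.cast_sum, Nat.cast_ite]
    exact Finset.measurable_sum _ fun u _ =>
      Measurable.ite (h.arm u b) measurable_const measurable_const
  unfold wucb empMean
  refine Measurable.add (Measurable.div ?_ hcount) (measurable_const.div hcount).sqrt
  exact Finset.measurable_sum _ fun u _ => Measurable.ite (h.arm u b) (h.rew u) measurable_const

theorem measurableSet_withdraw (h : MeasurableConfig c) (T : ℕ) (δ : ℝ) (sel : ℕ → 𝒜) (t : ℕ) :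
    MeasurableSet {ω | Withdraw T δ sel t (c ω)} := by
  have hunion : {ω | Withdraw T δ sel t (c ω)} = ⋃ k : ℕ, ⋃ r : ℕ,
      ({ω | (c ω).idx = k} ∩ {ω | (c ω).start = r}) ∩ ⋃ s ∈ windowStarts T r t,
        {ω | wucb T (c ω).arm (c ω).rew (sel k) s (t - 1) < 1 - δ} := by
    ext ω
    simp [Withdraw]
  rw [hunion]
  exact .iUnion fun k => .iUnion fun r =>
    ((h.idx (measurableSet_singleton k)).inter (h.start (measurableSet_singleton r))).inter
      (Finset.measurableSet_biUnion _ fun s _ =>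
        measurableSet_lt (h.measurable_wucb T (sel k) s (t - 1)) measurable_const)

theorem measurable_nextIdx (h : MeasurableConfig c) (T : ℕ) (δ : ℝ) (sel : ℕ → 𝒜) (t : ℕ) :
    Measurable fun ω => nextIdx T δ sel t (c ω) :=
  Measurable.ite (h.measurableSet_withdraw T δ sel t) (h.idx.add_const 1) h.idx

theorem comp_playRound (h : MeasurableConfig c) (T : ℕ) (δ : ℝ) (sel : ℕ → 𝒜) {η ρ : ℕ → Ω → ℝ}
    (hη : ∀ t, Measurable (η t)) (hρ : ∀ t, Measurable (ρ t)) (t : ℕ) :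
    MeasurableConfig fun ω => playRound T δ sel (fun t => η t ω) (fun t => ρ t ω) t (c ω) := by
  have hidx := h.measurable_nextIdx T δ sel t
  have hsel : ∀ b, MeasurableSet {ω | sel (nextIdx T δ sel t (c ω)) = b} :=
    fun b => hidx (MeasurableSet.of_discrete (s := {k : ℕ | sel k = b}))
  have hmean : Measurable fun ω => (c ω).mean (sel (nextIdx T δ sel t (c ω))) :=
    measurable_eval_nat (f := fun k ω => (c ω).mean (sel k)) (fun k => h.mean (sel k)) hidx
  refine ⟨hidx, Measurable.ite (h.measurableSet_withdraw T δ sel t) measurable_const h.start,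
    fun u b => ?_, fun u => ?_, fun b => ?_⟩
  · by_cases hu : u = t
    · subst hu
      simpa [playRound] using hsel b
    · simpa [playRound, hu] using h.arm u b
  · by_cases hu : u = t
    · subst hu
      simpa [playRound] using hmean.fun_add (hη u)
    · simpa [playRound, hu] using h.rew u
  · simp only [playRound, Function.update_apply]
    refine Measurable.ite ?_ (hmean.sub (hρ t)) (h.mean b)
    simpa only [eq_comm] using hsel b

end MeasurableConfig

theorem measurableConfig_run (T : ℕ) (δ : ℝ) (sel : ℕ → 𝒜) {μ₁ : 𝒜 → Ω → ℝ} {η ρ : ℕ → Ω → ℝ}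
    (hμ : ∀ a, Measurable (μ₁ a)) (hη : ∀ t, Measurable (η t)) (hρ : ∀ t, Measurable (ρ t))
    (t : ℕ) : MeasurableConfig fun ω =>
      run T δ sel (fun a => μ₁ a ω) (fun t => η t ω) (fun t => ρ t ω) t := by
  induction t with
  | zero => exact ⟨measurable_const, measurable_const, fun _ b => MeasurableSet.const (sel 0 = b),
      fun _ => measurable_const, hμ⟩
  | succ t ih => exact ih.comp_playRound T δ sel hη hρ (t + 1)

theorem measurable_regret (T : ℕ) (δ : ℝ) (sel : ℕ → 𝒜) {μ₁ : 𝒜 → Ω → ℝ} {η ρ : ℕ → Ω → ℝ}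
    (hμ : ∀ a, Measurable (μ₁ a)) (hη : ∀ t, Measurable (η t)) (hρ : ∀ t, Measurable (ρ t)) :
    Measurable fun ω =>
      regret T δ sel (fun a => μ₁ a ω) (fun t => η t ω) (fun t => ρ t ω) := by
  simp only [regret_eq_sum_gapAt]
  refine Finset.measurable_sum _ fun t _ => measurable_const.sub ?_
  exact measurable_eval_nat
    (f := fun k ω => (run T δ sel (fun a => μ₁ a ω) (fun t => η t ω) (fun t => ρ t ω)
      (t - 1)).mean (sel k))
    (fun k => (measurableConfig_run T δ sel hμ hη hρ (t - 1)).mean (sel k))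
    (measurableConfig_run T δ sel hμ hη hρ t).idx

end Measurability

/-! ### Sampling until enough hits -/

section Sampling

variable {E : Type*}

/-- The number of hits of `A` among the first `k` samples. -/
def hitCount (A : Set E) (y : ℕ → E) (k : ℕ) : ℕ :=
  #{j ∈ range k | y j ∈ A}

/-- The sum of `φ` over the samples taken until `A` has been hit `M` times (or `n` samples have
been taken). The sample that gives the `M`-th hit is included. -/
def sumUntilHits (A : Set E) (M : ℕ) (φ : E → ℝ) (y : ℕ → E) (n : ℕ) : ℝ :=
  ∑ k ∈ range n with hitCount A y k < M, φ (y k)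

theorem hitCount_mono (A : Set E) (y : ℕ → E) : Monotone (hitCount A y) := fun _ _ h =>
  card_le_card (filter_subset_filter _ (range_subset_range.2 h))

theorem hitCount_succ (A : Set E) (y : ℕ → E) (k : ℕ) :
    hitCount A y (k + 1) = hitCount A y k + if y k ∈ A then 1 else 0 := by
  simp only [hitCount, card_filter, sum_range_succ]

theorem sumUntilHits_indicator_one (A : Set E) (M : ℕ) (y : ℕ → E) (n : ℕ) :
    sumUntilHits A M (A.indicator 1) y n = min (hitCount A y n) M := by
  induction n with
  | zero =>
    rw [sumUntilHits, range_zero, filter_empty, sum_empty, hitCount, range_zero, filter_empty,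
      card_empty, Nat.zero_min, Nat.cast_zero]
  | succ n ih =>
    simp only [sumUntilHits, sum_filter, sum_range_succ, hitCount_succ] at ih ⊢
    rw [ih]
    norm_cast
    simp only [Set.indicator_apply, Pi.one_apply]
    split_ifs <;> norm_cast <;> omega

theorem sum_range_succ_le_sumUntilHits {A : Set E} {M : ℕ} {φ : E → ℝ} (hφ : ∀ x, 0 ≤ φ x)
    {y : ℕ → E} {k n : ℕ} (hkn : k < n) (hk : hitCount A y k < M) :
    ∑ j ∈ range (k + 1), φ (y j) ≤ sumUntilHits A M φ y n := by
  refine sum_le_sum_of_subset_of_nonneg (fun j hj => ?_) fun j _ _ => hφ _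
  rw [mem_range, Nat.lt_succ_iff] at hj
  exact mem_filter.2 ⟨mem_range.2 (hj.trans_lt hkn), (hitCount_mono A y hj).trans_lt hk⟩

theorem sumUntilHits_eq_sum_indicator (A : Set E) (M : ℕ) (φ : E → ℝ) (Y : ℕ → Ω → E) (n : ℕ)
    (ω : Ω) : sumUntilHits A M φ (fun j => Y j ω) n =
      ∑ k ∈ range n, {ω | hitCount A (fun j => Y j ω) k < M}.indicator (fun ω => φ (Y k ω)) ω := by
  simp only [sumUntilHits, sum_filter, Set.indicator_apply, Set.mem_ofPred_eq]

variable [MeasurableSpace E] [MeasurableSpace Ω] {P : Measure Ω} {Y : ℕ → Ω → E} {A : Set E}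
  {φ : E → ℝ}

theorem measurable_hitCount (hY : ∀ k, Measurable (Y k)) (hA : MeasurableSet A) (k : ℕ) :
    Measurable fun ω => hitCount A (fun j => Y j ω) k := by
  simp only [hitCount, card_filter]
  exact Finset.measurable_sum _ fun j _ => .ite (hY j hA) measurable_const measurable_const

theorem measurableSet_hitCount_lt (hY : ∀ k, Measurable (Y k)) (hA : MeasurableSet A) (M k : ℕ) :
    MeasurableSet {ω | hitCount A (fun j => Y j ω) k < M} :=
  measurable_hitCount hY hA k measurableSet_Iio

theorem indepFun_hitCount (hind : iIndepFun Y P) (hY : ∀ k, Measurable (Y k))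
    (hA : MeasurableSet A) (hφ : Measurable φ) (k : ℕ) :
    IndepFun (fun ω => φ (Y k ω)) (fun ω => (hitCount A (fun j => Y j ω) k : ℝ)) P := by
  have hone : Measurable (A.indicator (1 : E → ℝ)) := measurable_one.indicator hA
  have hmeas : ∀ j, Measurable (if j = k then φ else A.indicator 1) := fun j => by
    split_ifs <;> assumption
  have hsum := (hind.comp _ hmeas).indepFun_finsetSum_of_notMem
    (fun j => (hmeas j).comp (hY j)) (notMem_range_self (n := k))
  have hcount : (∑ j ∈ range k, (if j = k then φ else A.indicator 1) ∘ Y j) =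
      fun ω => (hitCount A (fun j => Y j ω) k : ℝ) := by
    funext ω
    rw [Finset.sum_apply, hitCount, card_filter, Nat.cast_sum]
    refine sum_congr rfl fun j hj => ?_
    simp [(mem_range.1 hj).ne, Set.indicator_apply]
  rw [hcount] at hsum
  simpa only [if_pos, Function.comp_def] using hsum.symm

theorem integrable_sumUntilHits (hY : ∀ k, Measurable (Y k)) (hA : MeasurableSet A)
    (hφY : ∀ k, Integrable (fun ω => φ (Y k ω)) P) (M n : ℕ) :
    Integrable (fun ω => sumUntilHits A M φ (fun j => Y j ω) n) P := by
  simp only [sumUntilHits_eq_sum_indicator]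
  exact integrable_finsetSum _ fun k _ =>
    (hφY k).indicator (measurableSet_hitCount_lt hY hA M k)

theorem integral_sumUntilHits (hind : iIndepFun Y P) (hY : ∀ k, Measurable (Y k))
    (hA : MeasurableSet A) (hφ : Measurable φ) (hφY : ∀ k, Integrable (fun ω => φ (Y k ω)) P)
    (M n : ℕ) :
    ∫ ω, sumUntilHits A M φ (fun j => Y j ω) n ∂P =
      ∑ k ∈ range n, (∫ ω, φ (Y k ω) ∂P) * P.real {ω | hitCount A (fun j => Y j ω) k < M} := by
  have hlt := measurableSet_hitCount_lt hY hA M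
  simp only [sumUntilHits_eq_sum_indicator]
  rw [integral_finsetSum _ fun k _ => (hφY k).indicator (hlt k)]
  refine sum_congr rfl fun k _ => ?_
  have hindep : IndepFun (fun ω => φ (Y k ω))
      ({ω | hitCount A (fun j => Y j ω) k < M}.indicator (1 : Ω → ℝ)) P := by
    have hfun : {ω | hitCount A (fun j => Y j ω) k < M}.indicator (1 : Ω → ℝ) =
        (Set.Iio (M : ℝ)).indicator 1 ∘ fun ω => (hitCount A (fun j => Y j ω) k : ℝ) := by
      ext ω
      simp [Set.indicator_apply]
    rw [hfun]
    exact (indepFun_hitCount hind hY hA hφ k).comp measurable_id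
      (measurable_one.indicator measurableSet_Iio)
  calc ∫ ω, {ω | hitCount A (fun j => Y j ω) k < M}.indicator (fun ω => φ (Y k ω)) ω ∂P
      = ∫ ω, φ (Y k ω) * {ω | hitCount A (fun j => Y j ω) k < M}.indicator (1 : Ω → ℝ) ω ∂P := by
        simp [Set.indicator_apply]
    _ = (∫ ω, φ (Y k ω) ∂P) *
          ∫ ω, {ω | hitCount A (fun j => Y j ω) k < M}.indicator (1 : Ω → ℝ) ω ∂P :=
        hindep.integral_fun_mul_eq_mul_integral (hφY k).aestronglyMeasurable
          (measurable_one.indicator (hlt k)).aestronglyMeasurable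
    _ = _ := by rw [integral_indicator_one (hlt k)]

-- Wald's argument: the bound on the number of samples comes from the identity for the sum of the
-- indicator of `A`, which is at most `M`.
theorem integral_sumUntilHits_le [IsProbabilityMeasure P] (hind : iIndepFun Y P)
    (hY : ∀ k, Measurable (Y k)) (hA : MeasurableSet A) (hφ : Measurable φ)
    (hφY : ∀ k, Integrable (fun ω => φ (Y k ω)) P) {p B : ℝ} (hp : 0 < p)
    (hpA : ∀ k, p ≤ P.real {ω | Y k ω ∈ A}) (hB₀ : 0 ≤ B) (hB : ∀ k, ∫ ω, φ (Y k ω) ∂P ≤ B)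
    (M n : ℕ) : ∫ ω, sumUntilHits A M φ (fun j => Y j ω) n ∂P ≤ M * B / p := by
  set q : ℕ → ℝ := fun k => P.real {ω | hitCount A (fun j => Y j ω) k < M}
  have hone : Measurable (A.indicator (1 : E → ℝ)) := measurable_one.indicator hA
  have hYA : ∀ k, MeasurableSet {ω | Y k ω ∈ A} := fun k => hY k hA
  have hsamples : ∑ k ∈ range n, q k ≤ M / p := by
    rw [le_div_iff₀' hp, mul_sum]
    calc ∑ k ∈ range n, p * q k
        ≤ ∑ k ∈ range n, (∫ ω, A.indicator 1 (Y k ω) ∂P) * q k := by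
          refine sum_le_sum fun k _ => mul_le_mul_of_nonneg_right ?_ measureReal_nonneg
          exact (hpA k).trans_eq (integral_indicator_one (hYA k)).symm
      _ = ∫ ω, ((min (hitCount A (fun j => Y j ω) n) M : ℕ) : ℝ) ∂P := by
          rw [← integral_sumUntilHits hind hY hA hone
            (fun k => (integrable_const (1 : ℝ)).indicator (hYA k)) M n]
          simp only [sumUntilHits_indicator_one]
      _ ≤ ∫ _, (M : ℝ) ∂P :=
          integral_mono_of_nonneg (.of_forall fun _ => by positivity) (integrable_const _)
            (.of_forall fun _ => Nat.cast_le.2 (min_le_right _ _))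
      _ = M := by simp
  calc ∫ ω, sumUntilHits A M φ (fun j => Y j ω) n ∂P
      ≤ ∑ k ∈ range n, B * q k := by
        rw [integral_sumUntilHits hind hY hA hφ hφY]
        exact sum_le_sum fun k _ => mul_le_mul_of_nonneg_right (hB k) measureReal_nonneg
    _ ≤ B * (M / p) := by
        rw [← mul_sum]
        exact mul_le_mul_of_nonneg_left hsamples hB₀
    _ = M * B / p := by ring

end Sampling

theorem integral_eq_intervalIntegral_measureReal_lt [MeasurableSpace Ω] {P : Measure Ω}
    [IsFiniteMeasure P] {f : Ω → ℝ} (hf : AEStronglyMeasurable f P) {M : ℝ} (hM : 0 ≤ M)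
    (hf_mem : ∀ ω, f ω ∈ Set.Icc 0 M) :
    ∫ ω, f ω ∂P = ∫ t in 0..M, P.real {ω | t < f ω} := by
  have hint : Integrable f P := .of_bound hf M <| .of_forall fun ω => by
    rw [Real.norm_of_nonneg (hf_mem ω).1]
    exact (hf_mem ω).2
  rw [hint.integral_eq_integral_meas_lt (.of_forall fun ω => (hf_mem ω).1),
    intervalIntegral.integral_of_le hM]
  refine setIntegral_eq_of_subset_of_ae_sdiff_eq_zero nullMeasurableSet_Ioi
    Set.Ioc_subset_Ioi_self (.of_forall fun t ht => ?_)
  have hMt : M < t := lt_of_not_ge fun h => ht.2 ⟨ht.1, h⟩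
  have hempty : {ω | t < f ω} = ∅ :=
    Set.eq_empty_of_forall_notMem fun ω hω => (hMt.trans hω).not_ge (hf_mem ω).2
  rw [hempty, measureReal_empty]

theorem measureReal_lt_one_div_max_le [MeasurableSpace Ω] {P : Measure Ω} [IsFiniteMeasure P]
    {Z : Ω → ℝ} {β hi δ : ℝ} (hδ : 0 < δ) (hhi : 0 ≤ hi)
    (hup : ∀ x ∈ Set.Icc (0 : ℝ) 1, P.real {ω | Z ω < x} ≤ hi * x ^ β) {t : ℝ}
    (ht : t ∈ Set.Icc 1 (1 / δ)) :
    P.real {ω | t < 1 / max (Z ω) δ} ≤ hi * δ ^ (β - max β 1) * t⁻¹ := by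
  have ht0 : 0 < t := zero_lt_one.trans_le ht.1
  have hδt : δ ≤ 1 / t := (le_one_div hδ ht0).2 ht.2
  have ht1 : 1 / t ≤ 1 := (div_le_one ht0).2 ht.1
  have hpow : (1 / t) ^ (β - 1) ≤ δ ^ (β - max β 1) := by
    rcases le_total β 1 with hβ | hβ
    · rw [max_eq_right hβ]
      exact Real.rpow_le_rpow_of_nonpos hδ hδt (sub_nonpos.2 hβ)
    · rw [max_eq_left hβ, sub_self, Real.rpow_zero]
      exact Real.rpow_le_one (by positivity) ht1 (sub_nonneg.2 hβ)
  calc P.real {ω | t < 1 / max (Z ω) δ}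
      ≤ P.real {ω | Z ω < 1 / t} := measureReal_mono fun ω (hω : t < 1 / max (Z ω) δ) =>
        (le_max_left _ _).trans_lt ((lt_one_div ht0 (lt_max_of_lt_right hδ)).1 hω)
    _ ≤ hi * (1 / t) ^ β := hup _ ⟨by positivity, ht1⟩
    _ = hi * (1 / t) ^ (β - 1) * t⁻¹ := by
        rw [Real.rpow_sub_one (by positivity)]
        field_simp
    _ ≤ hi * δ ^ (β - max β 1) * t⁻¹ := by gcongr

theorem integral_one_div_max_le [MeasurableSpace Ω] {P : Measure Ω} [IsProbabilityMeasure P]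
    {Z : Ω → ℝ} (hZ : Measurable Z) {β hi δ : ℝ} (hδ : 0 < δ) (hδ1 : δ ≤ 1)
    (hup : ∀ x ∈ Set.Icc (0 : ℝ) 1, P.real {ω | Z ω < x} ≤ hi * x ^ β) :
    ∫ ω, 1 / max (Z ω) δ ∂P ≤ δ ^ (β - max β 1) * (1 + hi * Real.log (1 / δ)) := by
  have hδinv : (1 : ℝ) ≤ 1 / δ := (one_le_div₀ hδ).2 hδ1
  have hhi : 0 ≤ hi := by simpa using measureReal_nonneg.trans (hup 1 ⟨zero_le_one, le_rfl⟩)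
  have hδpow : 1 ≤ δ ^ (β - max β 1) :=
    Real.one_le_rpow_of_pos_of_le_one_of_nonpos hδ hδ1 (sub_nonpos.2 (le_max_left _ _))
  have htail_int : ∀ a b,
      IntervalIntegrable (fun t => P.real {ω | t < 1 / max (Z ω) δ}) volume a b := fun a b =>
    Antitone.intervalIntegrable fun s t hst => measureReal_mono fun ω hω => hst.trans_lt hω
  have hhead : ∫ t in 0..1, P.real {ω | t < 1 / max (Z ω) δ} ≤ 1 := by
    simpa using intervalIntegral.integral_mono_on (μ := volume) zero_le_one (htail_int 0 1)
      intervalIntegrable_const fun t _ => measureReal_le_one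
  have htail : ∫ t in 1..1 / δ, P.real {ω | t < 1 / max (Z ω) δ} ≤
      hi * δ ^ (β - max β 1) * Real.log (1 / δ) := by
    refine (intervalIntegral.integral_mono_on hδinv (htail_int _ _) ?_ fun t ht =>
      measureReal_lt_one_div_max_le hδ hhi hup ht).trans_eq ?_
    · exact (intervalIntegral.intervalIntegrable_inv (f := fun t => t) (fun t ht =>
        (lt_inf_iff.2 ⟨zero_lt_one, by positivity⟩ |>.trans_le ht.1).ne')
        continuousOn_id).const_mul _
    · rw [intervalIntegral.integral_const_mul, integral_inv_of_pos zero_lt_one (by positivity),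
        div_one]
  rw [integral_eq_intervalIntegral_measureReal_lt (f := fun ω => 1 / max (Z ω) δ) (M := 1 / δ)
      (measurable_const.div (hZ.max measurable_const)).aestronglyMeasurable (by positivity)
      fun ω => ⟨one_div_nonneg.2 (hδ.le.trans (le_max_right _ _)),
        one_div_le_one_div_of_le hδ (le_max_right _ _)⟩,
    ← intervalIntegral.integral_add_adjacent_intervals (htail_int 0 1) (htail_int 1 _)]
  calc _ ≤ 1 + hi * δ ^ (β - max β 1) * Real.log (1 / δ) := add_le_add hhead htail
    _ ≤ δ ^ (β - max β 1) * (1 + hi * Real.log (1 / δ)) := by linarith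

/-! ### The regret of a given threshold -/

section Deterministic

variable {T : ℕ} {δ V : ℝ} {sel : ℕ → 𝒜} {m : 𝒜 → ℝ} {η ρ : ℕ → ℝ}

theorem gapAt_mem_Icc (hsel : Function.Injective sel) (hm : ∀ k, m (sel k) ∈ Set.Icc (0 : ℝ) 1)
    (hρ : ∀ t, 0 ≤ ρ t) (hV : ∑ t ∈ Ico 1 T, ρ t ≤ V) {t : ℕ} (ht : t ∈ Icc 1 T) :
    gapAt T δ sel m η ρ t ∈ Set.Icc 0 (1 + V) := by
  rw [mem_Icc] at ht
  rw [gapAt_eq hsel ht.1]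
  obtain ⟨hm₀, hm₁⟩ := hm (idxAt T δ sel m η ρ t)
  have hrot_le : ∑ u ∈ Ico 1 t with idxAt T δ sel m η ρ u = idxAt T δ sel m η ρ t, ρ u ≤ V :=
    (sum_le_sum_of_subset_of_nonneg ((filter_subset _ _).trans (Ico_subset_Ico_right ht.2))
      fun u _ _ => hρ u).trans hV
  exact ⟨add_nonneg (sub_nonneg.2 hm₁) (sum_nonneg fun u _ => hρ u), by linarith⟩

theorem regret_mem_Icc (hsel : Function.Injective sel) (hm : ∀ k, m (sel k) ∈ Set.Icc (0 : ℝ) 1)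
    (hρ : ∀ t, 0 ≤ ρ t) (hV : ∑ t ∈ Ico 1 T, ρ t ≤ V) :
    regret T δ sel m η ρ ∈ Set.Icc 0 (T * (1 + V)) := by
  rw [regret_eq_sum_gapAt]
  refine ⟨sum_nonneg fun t ht => (gapAt_mem_Icc hsel hm hρ hV ht).1, ?_⟩
  have h := sum_le_card_nsmul _ _ _ fun t ht =>
    (gapAt_mem_Icc (δ := δ) (η := η) hsel hm hρ hV ht).2
  rwa [Nat.card_Icc, Nat.add_sub_cancel, nsmul_eq_mul] at h

theorem regret_le_of_goodNoise (hsel : Function.Injective sel) (hm : ∀ k, 0 ≤ m (sel k))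
    (hρ : ∀ t, 0 ≤ ρ t) (hT : 1 ≤ T) (hδ : 0 < δ) (hV : ∑ t ∈ Ico 1 T, ρ t ≤ V) {M : ℕ}
    (hM : 2 * V / δ < M ∨ 1 + #{t ∈ Ico 1 T | ρ t ≠ 0} ≤ M) (hη : GoodNoise T η) :
    regret T δ sel m η ρ ≤ 2 * δ * T + (768 * Real.log T + 1) *
      sumUntilHits (Set.Iio (δ / 2)) M (fun y => 1 / max y δ) (fun k => 1 - m (sel k)) T + V := by
  have hpath := thresholdPath_run (δ := δ) (m := m) hsel hρ hη
  have hhits : hitCount (Set.Iio (δ / 2)) (fun k => 1 - m (sel k)) (idxAt T δ sel m η ρ T) < M :=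
    hM.elim (hpath.card_replaced_lt_of_slow hδ hT hV) fun hS =>
      (Nat.lt_one_add_iff.2 (hpath.card_replaced_le_of_abrupt hδ hT)).trans_le hS
  have hcost := sum_range_succ_le_sumUntilHits (φ := fun y => 1 / max y δ)
    (fun y => one_div_nonneg.2 (hδ.le.trans (le_max_right _ _))) (hpath.lt hT) hhits
  have hκ : 16 * (2 * √(12 * Real.log T)) ^ 2 + 1 = 768 * Real.log T + 1 := by
    rw [mul_pow, Real.sq_sqrt (by positivity)]
    ring
  calc regret T δ sel m η ρ
      ≤ 2 * δ * T + (768 * Real.log T + 1) *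
          (∑ k ∈ range (idxAt T δ sel m η ρ T + 1), 1 / max (1 - m (sel k)) δ) +
          ∑ t ∈ Ico 1 T, ρ t := by
        rw [regret_eq_sum_gapAt, ← hκ]
        exact hpath.sum_gap_le (by positivity) hδ fun k => sub_le_self _ (hm k)
    _ ≤ _ := by gcongr

end Deterministic

/-- The hypotheses on the initial mean rewards that the regret bound rests on: `InitialMeans`
without identical distribution, the two bounds on the tail being uniform over the arms. -/
structure IndepInitialMeans [MeasurableSpace Ω] (P : Measure Ω) (β lo hi : ℝ)
    (μ₁ : 𝒜 → Ω → ℝ) : Prop where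
  measurable : ∀ a, Measurable (μ₁ a)
  indep : iIndepFun μ₁ P
  mem_Icc : ∀ a, ∀ᵐ ω ∂P, μ₁ a ω ∈ Set.Icc (0 : ℝ) 1
  lower : ∀ a, ∀ x ∈ Set.Icc (0 : ℝ) 1, lo * x ^ β ≤ P.real {ω | 1 - x < μ₁ a ω}
  upper : ∀ a, ∀ x ∈ Set.Icc (0 : ℝ) 1, P.real {ω | 1 - x < μ₁ a ω} ≤ hi * x ^ β

/-- An adversary that obeys the slow and the abrupt rotting constraint of `AdaptiveAdversary` but
may know the future: the rates `ρ t` are arbitrary random variables. -/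
structure BudgetedRotting [MeasurableSpace Ω] (P : Measure Ω) (T : ℕ) (V : ℝ) (S : ℕ)
    (ρ : ℕ → Ω → ℝ) : Prop where
  measurable : ∀ t, Measurable (ρ t)
  nonneg : ∀ t, ∀ᵐ ω ∂P, 0 ≤ ρ t ω
  slow : ∀ᵐ ω ∂P, ∑ t ∈ Ico 1 T, ρ t ω ≤ V
  abrupt : ∀ᵐ ω ∂P, 1 + #{t ∈ Ico 1 T | ρ t ω ≠ 0} ≤ S

theorem InitialMeans.indepInitialMeans [MeasurableSpace Ω] {P : Measure Ω} {β lo hi : ℝ}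
    {μ₁ : 𝒜 → Ω → ℝ} (h : InitialMeans P β lo hi μ₁) : IndepInitialMeans P β lo hi μ₁ :=
  ⟨h.measurable, h.indep, h.mem_Icc, h.lower, h.upper⟩

theorem AdaptiveAdversary.budgetedRotting [mΩ : MeasurableSpace Ω] {P : Measure Ω}
    {ℱ : Filtration ℕ mΩ} {T S : ℕ} {V : ℝ} {ρ : ℕ → Ω → ℝ}
    (h : AdaptiveAdversary P ℱ T V S ρ) : BudgetedRotting P T V S ρ :=
  ⟨fun t => (h.adapted t).mono (ℱ.le t) le_rfl, h.nonneg, h.slow, h.abrupt⟩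

section ExpectedRegret

variable [mΩ : MeasurableSpace Ω] {P : Measure Ω}

theorem integral_le_integral_add_of_le_off [IsFiniteMeasure P] {R F : Ω → ℝ} {bad : Set Ω} {B : ℝ}
    (hbad : MeasurableSet bad) (hR : Integrable R P) (hF : Integrable F P) (hF₀ : 0 ≤ᵐ[P] F)
    (hRB : ∀ᵐ ω ∂P, R ω ≤ B) (hRF : ∀ᵐ ω ∂P, ω ∉ bad → R ω ≤ F ω) :
    ∫ ω, R ω ∂P ≤ ∫ ω, F ω ∂P + P.real bad * B := by
  have hB := (integrable_const (μ := P) B).indicator hbad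
  calc ∫ ω, R ω ∂P ≤ ∫ ω, (F ω + bad.indicator (fun _ => B) ω) ∂P := by
        refine integral_mono_ae hR (hF.add hB) ?_
        filter_upwards [hF₀, hRB, hRF] with ω hF₀ hRB hRF
        by_cases hω : ω ∈ bad
        · rw [Set.indicator_of_mem hω]
          exact hRB.trans (le_add_of_nonneg_left hF₀)
        · rw [Set.indicator_of_notMem hω, add_zero]
          exact hRF hω
    _ = ∫ ω, F ω ∂P + P.real bad * B := by
        rw [integral_add hF hB, integral_indicator_const _ hbad, smul_eq_mul]

variable {ℱ : Filtration ℕ mΩ} {μ₁ : 𝒜 → Ω → ℝ} {η ρ : ℕ → Ω → ℝ} {sel : ℕ → 𝒜}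
  {β lo hi V δ : ℝ} {T S : ℕ}

namespace IndepInitialMeans

theorem iIndepFun_gap (hμ : IndepInitialMeans P β lo hi μ₁) (hsel : Function.Injective sel) :
    iIndepFun (fun k ω => 1 - μ₁ (sel k) ω) P :=
  (hμ.indep.precomp hsel).comp (fun _ x => 1 - x) fun _ => measurable_const.sub measurable_id

theorem measurable_gap (hμ : IndepInitialMeans P β lo hi μ₁) (a : 𝒜) :
    Measurable fun ω => 1 - μ₁ a ω :=
  measurable_const.sub (hμ.measurable a)

end IndepInitialMeans

theorem ae_regret_mem_Icc (hμ : IndepInitialMeans P β lo hi μ₁) (hρ : BudgetedRotting P T V S ρ)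
    (hsel : Function.Injective sel) :
    ∀ᵐ ω ∂P, regret T δ sel (fun a => μ₁ a ω) (fun t => η t ω) (fun t => ρ t ω) ∈
      Set.Icc 0 (T * (1 + V)) := by
  filter_upwards [ae_all_iff.2 fun k => hμ.mem_Icc (sel k), ae_all_iff.2 hρ.nonneg, hρ.slow]
    with ω hm hρ₀ hV
  exact regret_mem_Icc hsel hm hρ₀ hV

variable [IsProbabilityMeasure P]

namespace IndepInitialMeans

theorem integrable_one_div_max_gap (hμ : IndepInitialMeans P β lo hi μ₁) (hδ : 0 < δ) (a : 𝒜) :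
    Integrable (fun ω => 1 / max (1 - μ₁ a ω) δ) P := by
  refine .of_bound (measurable_const.div
    ((hμ.measurable_gap a).max measurable_const)).aestronglyMeasurable (1 / δ)
    (.of_forall fun ω => ?_)
  rw [Real.norm_of_nonneg (one_div_nonneg.2 (hδ.le.trans (le_max_right _ _)))]
  exact one_div_le_one_div_of_le hδ (le_max_right _ _)

theorem integral_sumUntilHits_le (hμ : IndepInitialMeans P β lo hi μ₁)
    (hsel : Function.Injective sel) (hlo : 0 < lo) (hhi : 0 < hi) (hδ : 0 < δ) (hδ1 : δ ≤ 1)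
    (M n : ℕ) :
    ∫ ω, sumUntilHits (Set.Iio (δ / 2)) M (fun y => 1 / max y δ)
        (fun k => 1 - μ₁ (sel k) ω) n ∂P ≤
      2 ^ β / lo * (1 + hi * Real.log (1 / δ)) * (M * δ ^ (-max β 1)) := by
  have htail : ∀ k x, {ω | 1 - μ₁ (sel k) ω < x} = {ω | 1 - x < μ₁ (sel k) ω} := fun k x => by
    ext ω
    exact (sub_lt_comm : 1 - μ₁ (sel k) ω < x ↔ 1 - x < μ₁ (sel k) ω)
  have hlog : 0 ≤ Real.log (1 / δ) := Real.log_nonneg ((one_le_div₀ hδ).2 hδ1)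
  refine (RottingBandit.integral_sumUntilHits_le (hμ.iIndepFun_gap hsel)
    (fun k => hμ.measurable_gap (sel k)) measurableSet_Iio
    (measurable_const.div (measurable_id.max measurable_const))
    (fun k => hμ.integrable_one_div_max_gap hδ (sel k))
    (p := lo * (δ / 2) ^ β) (B := δ ^ (β - max β 1) * (1 + hi * Real.log (1 / δ)))
    (by positivity) (fun k => ?_) (by positivity) (fun k => ?_) M n).trans_eq ?_
  · rw [show {ω | 1 - μ₁ (sel k) ω ∈ Set.Iio (δ / 2)} = _ from htail k (δ / 2)]
    exact hμ.lower (sel k) (δ / 2) ⟨by positivity, by linarith⟩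
  · exact integral_one_div_max_le (hμ.measurable_gap (sel k)) hδ hδ1 fun x hx =>
      (congrArg P.real (htail k x)).trans_le (hμ.upper (sel k) x hx)
  · rw [Real.div_rpow hδ.le zero_le_two, sub_eq_add_neg, Real.rpow_add hδ]
    field_simp

end IndepInitialMeans

theorem integrable_regret (hμ : IndepInitialMeans P β lo hi μ₁) (hη : ∀ t, Measurable (η t))
    (hρ : BudgetedRotting P T V S ρ) (hsel : Function.Injective sel) (δ : ℝ) :
    Integrable (fun ω => regret T δ sel (fun a => μ₁ a ω) (fun t => η t ω) fun t => ρ t ω) P := by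
  refine .of_bound (measurable_regret T δ sel hμ.measurable hη hρ.measurable).aestronglyMeasurable
    (T * (1 + V)) ?_
  filter_upwards [ae_regret_mem_Icc hμ hρ hsel] with ω hω
  rw [Real.norm_of_nonneg hω.1]
  exact hω.2

theorem integral_regret_le (hμ : IndepInitialMeans P β lo hi μ₁) (hη : SubGaussianNoise P ℱ η)
    (hρ : BudgetedRotting P T V S ρ) (hsel : Function.Injective sel) (hlo : 0 < lo) (hhi : 0 < hi)
    (hT : 1 ≤ T) (hV₀ : 0 ≤ V) (hVT : V ≤ T) (hδ : 0 < δ) (hδ1 : δ ≤ 1) {M : ℕ}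
    (hM : 2 * V / δ < M ∨ S ≤ M) :
    ∫ ω, regret T δ sel (fun a => μ₁ a ω) (fun t => η t ω) (fun t => ρ t ω) ∂P ≤
      2 * δ * T + (768 * Real.log T + 1) *
        (2 ^ β / lo * (1 + hi * Real.log (1 / δ)) * (M * δ ^ (-max β 1))) + V + 4 := by
  have hT0 : (1 : ℝ) ≤ T := by exact_mod_cast hT
  set Q : Ω → ℝ := fun ω => sumUntilHits (Set.Iio (δ / 2)) M (fun y => 1 / max y δ)
    (fun k => 1 - μ₁ (sel k) ω) T
  have hQ : Integrable Q P := integrable_sumUntilHits (fun k => hμ.measurable_gap (sel k))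
    measurableSet_Iio (fun k => hμ.integrable_one_div_max_gap hδ (sel k)) M T
  have hF : Integrable (fun ω => 2 * δ * T + (768 * Real.log T + 1) * Q ω) P :=
    (integrable_const _).add (hQ.const_mul _)
  have hQ₀ : ∀ ω, 0 ≤ Q ω := fun ω =>
    sum_nonneg fun k _ => one_div_nonneg.2 (hδ.le.trans (le_max_right _ _))
  have hbad : P.real {ω | ¬ GoodNoise T fun t => η t ω} * (T * (1 + V)) ≤ 4 :=
    calc _ ≤ 2 / (T : ℝ) ^ 4 * (T * (T + T)) := by
          gcongr
          exact hη.measureReal_not_goodNoise_le hT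
      _ = 4 / (T : ℝ) ^ 2 := by
          field_simp
          norm_num
      _ ≤ 4 := div_le_self (by norm_num) (one_le_pow₀ hT0)
  calc _ ≤ ∫ ω, (2 * δ * T + (768 * Real.log T + 1) * Q ω + V) ∂P +
        P.real {ω | ¬ GoodNoise T fun t => η t ω} * (T * (1 + V)) := by
        refine integral_le_integral_add_of_le_off (hη.measurableSet_goodNoise T).compl
          (integrable_regret hμ hη.measurable hρ hsel δ)
          (hF.add (integrable_const V)) (.of_forall fun ω => ?_)
          ((ae_regret_mem_Icc hμ hρ hsel).mono fun ω hω => hω.2) ?_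
        · have := hQ₀ ω
          positivity
        · filter_upwards [ae_all_iff.2 fun k => hμ.mem_Icc (sel k), ae_all_iff.2 hρ.nonneg,
            hρ.slow, hρ.abrupt] with ω hm hρ₀ hV hS hgood
          exact regret_le_of_goodNoise hsel (fun k => (hm k).1) hρ₀ hT hδ hV
            (hM.imp_right hS.trans) (not_not.1 hgood)
    _ ≤ 2 * δ * T + (768 * Real.log T + 1) * (∫ ω, Q ω ∂P) + V + 4 := by
        rw [integral_add hF (integrable_const V),
          integral_add (integrable_const _) (hQ.const_mul _), integral_const_mul _ Q]
        simpa using hbad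
    _ ≤ _ := by
        gcongr
        exact hμ.integral_sumUntilHits_le hsel hlo hhi hδ hδ1 M T

end ExpectedRegret

/-! ### Tuning the threshold -/

/-- The constant in front of `δ T + M δ^{-max β 1} + V` in the regret bound for thresholds
`δ ≥ c / T`. -/
def regretConst (β c lo hi : ℝ) : ℝ :=
  2 + 4 / c + 768 * (2 ^ β / lo * (1 + hi * (1 + Real.log (1 / c))))

/-- The common scale of `δ_V` and `R_V`. As `max β 1 = 1` for `β < 1`, it covers both cases of
their definitions. -/
def scaleV (β V : ℝ) (T : ℕ) : ℝ :=
  max ((V / T) ^ (1 / (max β 1 + 2))) ((T : ℝ) ^ (-(1 / (max β 1 + 1))))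

/-- The common scale of `δ_S` and `R_S`. -/
def scaleS (β : ℝ) (S T : ℕ) : ℝ :=
  ((S : ℝ) / T) ^ (1 / (max β 1 + 1))

section Tuning

variable {β c lo hi V δ x y a : ℝ} {S T M : ℕ}

theorem log_one_div_nonneg (hc : 0 < c) (hc1 : c ≤ 1) : 0 ≤ Real.log (1 / c) :=
  Real.log_nonneg ((one_le_div₀ hc).2 hc1)

theorem regretConst_pos (hc : 0 < c) (hc1 : c ≤ 1) (hlo : 0 < lo) (hhi : 0 < hi) :
    0 < regretConst β c lo hi := by
  have := log_one_div_nonneg hc hc1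
  unfold regretConst
  positivity

theorem log_one_div_le (hc : 0 < c) (hT : 1 ≤ T) (hδT : c / T ≤ δ) :
    Real.log (1 / δ) ≤ Real.log (1 / c) + Real.log T := by
  have : (0 : ℝ) < T := by exact_mod_cast hT
  rw [← Real.log_mul (by positivity) (by positivity), one_div_mul_eq_div, ← one_div_div c]
  have hpos : 0 < c / T := by positivity
  exact Real.log_le_log (one_div_pos.2 (hpos.trans_le hδT)) (one_div_le_one_div_of_le hpos hδT)

theorem log_factor_le (hc : 0 < c) (hc1 : c ≤ 1) (hhi : 0 ≤ hi) (hT : 1 ≤ T) (hδ1 : δ ≤ 1)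
    (hδT : c / T ≤ δ) :
    (768 * Real.log T + 1) * (1 + hi * Real.log (1 / δ)) ≤
      768 * (1 + hi * (1 + Real.log (1 / c))) * (1 + Real.log T) ^ 2 := by
  have : (0 : ℝ) < T := by exact_mod_cast hT
  have hL : 0 ≤ Real.log T := Real.log_natCast_nonneg T
  have hℓ := log_one_div_nonneg hc hc1
  have hlogδ₀ := log_one_div_nonneg (lt_of_lt_of_le (by positivity) hδT) hδ1
  have hlogδ : 1 + hi * Real.log (1 / δ) ≤
      (1 + hi * (1 + Real.log (1 / c))) * (1 + Real.log T) := by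
    nlinarith [mul_le_mul_of_nonneg_left (log_one_div_le hc hT hδT) hhi,
      mul_nonneg hhi (mul_nonneg hℓ hL)]
  calc (768 * Real.log T + 1) * (1 + hi * Real.log (1 / δ))
      ≤ (768 * (1 + Real.log T)) *
          ((1 + hi * (1 + Real.log (1 / c))) * (1 + Real.log T)) := by
        gcongr
        linarith
    _ = _ := by ring

theorem regret_bound_le (hc : 0 < c) (hc1 : c ≤ 1) (hlo : 0 < lo) (hhi : 0 ≤ hi) (hT : 1 ≤ T)
    (hV : 0 ≤ V) (hδ1 : δ ≤ 1) (hδT : c / T ≤ δ) :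
    2 * δ * T + (768 * Real.log T + 1) *
        (2 ^ β / lo * (1 + hi * Real.log (1 / δ)) * (M * δ ^ (-max β 1))) + V + 4 ≤
      regretConst β c lo hi * (1 + Real.log T) ^ 2 * (δ * T + M * δ ^ (-max β 1) + V) := by
  have hT0 : (0 : ℝ) < T := by exact_mod_cast hT
  have hδ : 0 < δ := lt_of_lt_of_le (by positivity) hδT
  have hL : 0 ≤ Real.log T := Real.log_natCast_nonneg T
  have hℓ := log_one_div_nonneg hc hc1
  have hfour : 4 ≤ 4 / c * (δ * T) := by
    rw [div_mul_eq_mul_div, le_div_iff₀ hc]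
    linarith [(div_le_iff₀ hT0).1 hδT]
  have hN : 0 ≤ M * δ ^ (-max β 1) := by positivity
  set N := M * δ ^ (-max β 1)
  calc 2 * δ * T + (768 * Real.log T + 1) * (2 ^ β / lo * (1 + hi * Real.log (1 / δ)) * N) + V + 4
      = (2 * δ * T + V + 4) +
          2 ^ β / lo * ((768 * Real.log T + 1) * (1 + hi * Real.log (1 / δ))) * N := by ring
    _ ≤ (2 + 4 / c) * (1 + Real.log T) ^ 2 * (δ * T + N + V) + 2 ^ β / lo *
          (768 * (1 + hi * (1 + Real.log (1 / c))) * (1 + Real.log T) ^ 2) * (δ * T + N + V) := by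
        refine add_le_add ?_ ?_
        · calc 2 * δ * T + V + 4 ≤ (2 + 4 / c) * (δ * T + N + V) := by
                have : 0 ≤ 4 / c * (N + V) := by positivity
                linarith
            _ ≤ _ := by
                gcongr
                exact le_mul_of_one_le_right (by positivity) (one_le_pow₀ (by linarith))
        · have hN_le : N ≤ δ * T + N + V := by linarith [mul_pos hδ hT0]
          exact mul_le_mul (mul_le_mul_of_nonneg_left (log_factor_le hc hc1 hhi hT hδ1 hδT)
            (by positivity)) hN_le hN (by positivity)
    _ = regretConst β c lo hi * (1 + Real.log T) ^ 2 * (δ * T + N + V) := by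
        rw [regretConst]
        ring

theorem deltaV_eq (c β V : ℝ) (T : ℕ) : deltaV c β V T = c * scaleV β V T := by
  unfold deltaV scaleV
  split_ifs with h
  · rw [max_eq_left h, Real.rpow_neg (Nat.cast_nonneg T), one_div ((T : ℝ) ^ _)]
  · rw [max_eq_right (not_le.1 h).le, Real.rpow_neg (Nat.cast_nonneg T), Real.sqrt_eq_rpow]
    norm_num

theorem deltaS_eq (c β : ℝ) (S T : ℕ) : deltaS c β S T = c * scaleS β S T := by
  unfold deltaS scaleS
  split_ifs with h
  · rw [max_eq_left h]
  · rw [max_eq_right (not_le.1 h).le, one_add_one_eq_two]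

theorem mul_div_rpow (hx : 0 ≤ x) (hy : 0 < y) : y * (x / y) ^ a = x ^ a * y ^ (1 - a) := by
  rw [Real.div_rpow hx hy.le, Real.rpow_sub hy, Real.rpow_one]
  ring

theorem le_mul_scaleV (hT : 1 ≤ T) (hV : 0 ≤ V) (hVT : V ≤ T) : V ≤ T * scaleV β V T := by
  have hT0 : (0 : ℝ) < T := by exact_mod_cast hT
  have hγ : 1 ≤ max β 1 := le_max_right _ _
  rw [← div_le_iff₀' hT0]
  exact (Real.self_le_rpow_of_le_one (by positivity) ((div_le_one hT0).2 hVT)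
    ((div_le_one (by positivity)).2 (by linarith))).trans (le_max_left _ _)

theorem rateV_eq (hT : 1 ≤ T) (hV : 0 ≤ V) (hVT : V ≤ T) :
    rateV β V T = max (T * scaleV β V T) V := by
  have hT0 : (0 : ℝ) < T := by exact_mod_cast hT
  have hneg (a : ℝ) : (T : ℝ) * (T : ℝ) ^ (-a) = (T : ℝ) ^ (1 - a) := by
    rw [sub_eq_add_neg, Real.rpow_add hT0, Real.rpow_one]
  rw [max_eq_left (le_mul_scaleV hT hV hVT)]
  unfold rateV scaleV
  rw [mul_max_of_nonneg _ _ hT0.le, mul_div_rpow hV hT0, hneg]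
  split_ifs with h
  · rw [max_eq_left h, one_sub_div (by positivity), one_sub_div (by positivity)]
    ring_nf
  · rw [max_eq_right (not_le.1 h).le, Real.sqrt_eq_rpow]
    norm_num

theorem rateS_eq (hT : 1 ≤ T) : rateS β V S T = max (T * scaleS β S T) V := by
  have hT0 : (0 : ℝ) < T := by exact_mod_cast hT
  unfold rateS scaleS
  rw [mul_div_rpow (Nat.cast_nonneg S) hT0]
  split_ifs with h
  · rw [max_eq_left h, one_sub_div (by positivity), add_sub_cancel_right]
  · rw [max_eq_right (not_le.1 h).le, Real.sqrt_eq_rpow, Real.mul_rpow (by positivity) hT0.le]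
    norm_num

theorem min_delta_eq (hc : 0 ≤ c) :
    min (deltaV c β V T) (deltaS c β S T) = c * min (scaleV β V T) (scaleS β S T) := by
  rw [deltaV_eq, deltaS_eq, mul_min_of_nonneg _ _ hc]

theorem min_rate_eq (hT : 1 ≤ T) (hV : 0 ≤ V) (hVT : V ≤ T) :
    min (rateV β V T) (rateS β V S T) = max (T * min (scaleV β V T) (scaleS β S T)) V := by
  rw [rateV_eq hT hV hVT, rateS_eq hT, ← max_min_distrib_right,
    mul_min_of_nonneg _ _ (Nat.cast_nonneg T)]

theorem le_rpow_of_rpow_one_div_le (hx : 0 ≤ x) (ha : 0 < a) (h : x ^ (1 / a) ≤ y) : x ≤ y ^ a := by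
  rw [one_div] at h
  exact (Real.rpow_inv_le_iff_of_pos hx ((Real.rpow_nonneg hx _).trans h) ha).1 h

theorem le_mul_scaleV_rpow (hT : 1 ≤ T) (hV : 0 ≤ V) :
    V ≤ T * scaleV β V T ^ (max β 1 + 2) := by
  have hT0 : (0 : ℝ) < T := by exact_mod_cast hT
  exact (div_le_iff₀' hT0).1
    (le_rpow_of_rpow_one_div_le (by positivity) (by positivity) (le_max_left _ _))

theorem one_le_mul_scaleV_rpow (hT : 1 ≤ T) : 1 ≤ T * scaleV β V T ^ (max β 1 + 1) := by
  have hT0 : (0 : ℝ) < T := by exact_mod_cast hT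
  refine (div_le_iff₀' hT0).1 (le_rpow_of_rpow_one_div_le (by positivity) (by positivity) ?_)
  rw [one_div (T : ℝ), Real.inv_rpow hT0.le, ← Real.rpow_neg hT0.le]
  exact le_max_right _ _

theorem le_mul_scaleS_rpow (hT : 1 ≤ T) : S ≤ T * scaleS β S T ^ (max β 1 + 1) := by
  have hT0 : (0 : ℝ) < T := by exact_mod_cast hT
  exact (div_le_iff₀' hT0).1 (le_rpow_of_rpow_one_div_le (by positivity) (by positivity) le_rfl)

theorem scaleV_le_one (hT : 1 ≤ T) (hV : 0 ≤ V) (hVT : V ≤ T) : scaleV β V T ≤ 1 := by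
  have hT0 : (1 : ℝ) ≤ T := by exact_mod_cast hT
  exact max_le (Real.rpow_le_one (by positivity) ((div_le_one (by linarith)).2 hVT) (by positivity))
    (Real.rpow_le_one_of_one_le_of_nonpos hT0 (neg_nonpos.2 (by positivity)))

theorem one_div_le_scaleV (hT : 1 ≤ T) : 1 / (T : ℝ) ≤ scaleV β V T := by
  have hγ : 1 ≤ max β 1 := le_max_right _ _
  rw [one_div, ← Real.rpow_neg_one]
  exact (Real.rpow_le_rpow_of_exponent_le (by exact_mod_cast hT)
    (neg_le_neg ((div_le_one (by positivity)).2 (by linarith)))).trans (le_max_right _ _)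

theorem one_div_le_scaleS (hS : 1 ≤ S) (hST : S ≤ T) : 1 / (T : ℝ) ≤ scaleS β S T := by
  have hγ : 1 ≤ max β 1 := le_max_right _ _
  have hT0 : (0 : ℝ) < T := by exact_mod_cast hS.trans hST
  calc 1 / (T : ℝ) ≤ S / T := by
        gcongr
        exact_mod_cast hS
    _ ≤ scaleS β S T := Real.self_le_rpow_of_le_one (by positivity)
        ((div_le_one hT0).2 (by exact_mod_cast hST)) ((div_le_one (by positivity)).2 (by linarith))

theorem exists_hitBudget_of_slow (hc : 0 < c) (hc1 : c ≤ 1) (hT : 1 ≤ T) (hV : 0 ≤ V) :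
    ∃ M : ℕ, 2 * V / (c * scaleV β V T) < M ∧
      M ≤ 3 / c * (T * scaleV β V T ^ (max β 1 + 1)) := by
  have hT0 : (0 : ℝ) < T := by exact_mod_cast hT
  have hD : 0 < scaleV β V T := (one_div_pos.2 hT0).trans_le (one_div_le_scaleV hT)
  have hVD := le_mul_scaleV_rpow (β := β) hT hV
  have hone := one_le_mul_scaleV_rpow (β := β) (V := V) hT
  set D := scaleV β V T
  refine ⟨⌊2 * V / (c * D)⌋₊ + 1, by exact_mod_cast Nat.lt_floor_add_one _, ?_⟩
  calc ((⌊2 * V / (c * D)⌋₊ + 1 : ℕ) : ℝ) ≤ 2 * V / (c * D) + 1 := by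
        push_cast
        gcongr
        exact Nat.floor_le (by positivity)
    _ ≤ 2 * (T * D ^ (max β 1 + 2)) / (c * D) + 1 / c * (T * D ^ (max β 1 + 1)) := by
        gcongr
        exact one_le_mul_of_one_le_of_one_le ((one_le_div₀ hc).2 hc1) hone
    _ = 3 / c * (T * D ^ (max β 1 + 1)) := by
        rw [show max β 1 + 2 = max β 1 + 1 + 1 by ring, Real.rpow_add_one hD.ne']
        field_simp
        norm_num

theorem exists_hitBudget (hc : 0 < c) (hc1 : c ≤ 1) (hT : 1 ≤ T) (hV : 0 ≤ V) :
    ∃ M : ℕ, (2 * V / (c * min (scaleV β V T) (scaleS β S T)) < M ∨ S ≤ M) ∧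
      M ≤ 3 / c * (T * min (scaleV β V T) (scaleS β S T) ^ (max β 1 + 1)) := by
  rcases le_total (scaleV β V T) (scaleS β S T) with h | h
  · rw [min_eq_left h]
    exact (exists_hitBudget_of_slow hc hc1 hT hV).imp fun M hM => hM.imp_left .inl
  · rw [min_eq_right h]
    have hS := le_mul_scaleS_rpow (β := β) (S := S) hT
    exact ⟨S, .inr le_rfl, hS.trans (le_mul_of_one_le_left ((Nat.cast_nonneg S).trans hS)
      ((one_le_div₀ hc).2 (by linarith)))⟩

theorem tuned_bound_le (hc : 0 < c) (hc1 : c ≤ 1) (hx : 0 < x) (hT : 1 ≤ T)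
    (hM : M ≤ 3 / c * (T * x ^ (a + 1))) :
    c * x * T + M * (c * x) ^ (-a) + V ≤ (2 + 3 * c ^ (-(a + 1))) * max (T * x) V := by
  have : (0 : ℝ) < T := by exact_mod_cast hT
  have hTx := le_max_left (T * x) V
  have hdelay : M * (c * x) ^ (-a) ≤ 3 * c ^ (-(a + 1)) * (T * x) :=
    calc M * (c * x) ^ (-a) ≤ 3 / c * (T * x ^ (a + 1)) * (c * x) ^ (-a) := by gcongr
      _ = 3 * c ^ (-(a + 1)) * (T * x) := by
          rw [Real.mul_rpow hc.le hx.le, Real.rpow_add_one hx.ne', neg_add, Real.rpow_add hc,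
            Real.rpow_neg_one, Real.rpow_neg hx.le]
          field_simp
  have hscale : c * x * T ≤ T * x := by
    rw [mul_assoc, mul_comm x]
    exact mul_le_of_le_one_left (by positivity) hc1
  have hmax : 3 * c ^ (-(a + 1)) * (T * x) ≤ 3 * c ^ (-(a + 1)) * max (T * x) V := by gcongr
  linarith [le_max_right (T * x) V]

end Tuning

end

end RottingBandit

open RottingBandit in
theorem corollary1_general (β c₁ lo hi : ℝ) (hc₁ : 0 < c₁) (hc₁' : c₁ ≤ 1) (hlo : 0 < lo)
    (hhi : 0 < hi) :
    ∃ (C : ℝ) (k : ℕ), 0 < C ∧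
      ∀ (T : ℕ) (V : ℝ) (S : ℕ), 1 ≤ T → 0 ≤ V → V ≤ T → 1 ≤ S → S ≤ T →
      ∀ (𝒜 : Type*) (Ω : Type*) (mΩ : MeasurableSpace Ω) (P : Measure Ω) [IsProbabilityMeasure P]
        (ℱ : Filtration ℕ mΩ) (μ₁ : 𝒜 → Ω → ℝ) (η ρ : ℕ → Ω → ℝ) (sel : ℕ → 𝒜),
        IndepInitialMeans P β lo hi μ₁ →
        SubGaussianNoise P ℱ η →
        BudgetedRotting P T V S ρ →
        Function.Injective sel →
        Integrable (fun ω => regret T (min (deltaV c₁ β V T) (deltaS c₁ β S T)) sel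
            (fun a => μ₁ a ω) (fun t => η t ω) (fun t => ρ t ω)) P ∧
          ∫ ω, regret T (min (deltaV c₁ β V T) (deltaS c₁ β S T)) sel
              (fun a => μ₁ a ω) (fun t => η t ω) (fun t => ρ t ω) ∂P ≤
            C * (1 + Real.log T) ^ k * min (rateV β V T) (rateS β V S T) := by
  have hK := regretConst_pos (β := β) hc₁ hc₁' hlo hhi
  refine ⟨regretConst β c₁ lo hi * (2 + 3 * c₁ ^ (-(max β 1 + 1))), 2, by positivity, ?_⟩
  intro T V S hT hV hVT hS hST 𝒜 Ω mΩ P _ ℱ μ₁ η ρ sel hμ hη hρ hsel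
  refine ⟨integrable_regret hμ hη.measurable hρ hsel _, ?_⟩
  have hT0 : (0 : ℝ) < T := by exact_mod_cast hT
  have hD1 : min (scaleV β V T) (scaleS β S T) ≤ 1 :=
    (min_le_left _ _).trans (scaleV_le_one hT hV hVT)
  have hDT : 1 / (T : ℝ) ≤ min (scaleV β V T) (scaleS β S T) :=
    le_min (one_div_le_scaleV hT) (one_div_le_scaleS hS hST)
  obtain ⟨M, hM, hM_le⟩ := exists_hitBudget (β := β) (S := S) hc₁ hc₁' hT hV
  rw [min_delta_eq hc₁.le, min_rate_eq hT hV hVT]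
  set D := min (scaleV β V T) (scaleS β S T)
  have hD : 0 < D := (one_div_pos.2 hT0).trans_le hDT
  have hδ1 : c₁ * D ≤ 1 := mul_le_one₀ hc₁' hD.le hD1
  have hδT : c₁ / T ≤ c₁ * D := by
    rw [div_eq_mul_one_div]
    gcongr
  calc _ ≤ _ := integral_regret_le hμ hη hρ hsel hlo hhi hT hV hVT (mul_pos hc₁ hD) hδ1 hM
    _ ≤ regretConst β c₁ lo hi * (1 + Real.log T) ^ 2 *
          (c₁ * D * T + M * (c₁ * D) ^ (-max β 1) + V) :=
        regret_bound_le hc₁ hc₁' hlo hhi.le hT hV hδ1 hδT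
    _ ≤ regretConst β c₁ lo hi * (1 + Real.log T) ^ 2 *
          ((2 + 3 * c₁ ^ (-(max β 1 + 1))) * max (T * D) V) := by
        gcongr
        exact tuned_bound_le hc₁ hc₁' hD hT hM_le
    _ = _ := by ring

theorem corollary1 (β c₁ lo hi : ℝ) (hβ : 0 < β) (hc₁ : 0 < c₁) (hc₁' : c₁ < 1)
    (hlo : 0 < lo) (hhi : 0 < hi) :
    ∃ (C : ℝ) (k : ℕ), 0 < C ∧
      ∀ (T : ℕ) (V : ℝ) (S : ℕ), 1 ≤ T → 0 ≤ V → V ≤ T → 1 ≤ S → S ≤ T →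
      ∀ (𝒜 : Type*) (Ω : Type*) (mΩ : MeasurableSpace Ω) (P : Measure Ω) [IsProbabilityMeasure P]
        (ℱ : Filtration ℕ mΩ) (μ₁ : 𝒜 → Ω → ℝ) (η ρ : ℕ → Ω → ℝ) (sel : ℕ → 𝒜),
        RottingBandit.InitialMeans P β lo hi μ₁ →
        (∀ a, Measurable[ℱ 0] (μ₁ a)) →
        RottingBandit.SubGaussianNoise P ℱ η →
        RottingBandit.AdaptiveAdversary P ℱ T V S ρ →
        Function.Injective sel →
        Integrable (fun ω => RottingBandit.regret T
            (min (RottingBandit.deltaV c₁ β V T) (RottingBandit.deltaS c₁ β S T)) sel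
            (fun a => μ₁ a ω) (fun t => η t ω) (fun t => ρ t ω)) P ∧
          ∫ ω, RottingBandit.regret T
              (min (RottingBandit.deltaV c₁ β V T) (RottingBandit.deltaS c₁ β S T)) sel
              (fun a => μ₁ a ω) (fun t => η t ω) (fun t => ρ t ω) ∂P ≤
            C * (1 + Real.log T) ^ k *
              min (RottingBandit.rateV β V T) (RottingBandit.rateS β V S T) := by
  obtain ⟨C, k, hC, h⟩ := corollary1_general β c₁ lo hi hc₁ hc₁'.le hlo hhi
  exact ⟨C, k, hC, fun T V S hT hV hVT hS hST 𝒜 Ω mΩ P _ ℱ μ₁ η ρ sel hμ _ hη hρ hsel =>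
    h T V S hT hV hVT hS hST 𝒜 Ω mΩ P ℱ μ₁ η ρ sel hμ.indepInitialMeans hη hρ.budgetedRotting hsel⟩
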